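/- Let $T$ be an oblique triangle in the Euclidean plane, that is, a triangle none of whose angles is a right angle. A reptiling of $T$ is a subdivision of $T$ into $r \ge 2$ triangles (tiles) with pairwise disjoint interiors such that every tile is similar to $T$ and all tiles are mutually congruent. For a natural number $n\geq 1$, the trivial $n^2$-reptiling of $T$ is obtained by dividing every side of $T$ into $n$ segments of equal length and cutting $T$ along all lines that are parallel to a side of $T$ and pass through an endpoint of one of these segments. A vertex of a reptiling is a point that is a corner of at least one tile. A half vertex is a vertex that lies in the interior of a side of $T$, or that lies on the sides of exactly one tile without being a corner of that tile. Theorem. If a reptiling of an oblique triangle $T$ is not the trivial $n^2$-reptiling of $T$ for any $n$, then it has a half vertex in the interior of $T$ (a hanging vertex); that is, some corner of a tile lies in the interior of $T$ and in the relative interior of a side of exactly one other tile. -/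

import Mathlib

noncomputable section

namespace Reptile

/-- The Euclidean plane. -/
abbrev Plane : Type := EuclideanSpace ℝ (Fin 2)

/-- Non-degenerate triangles in the plane, with labelled corners `T.points 0, 1, 2`.
The labelling plays no role in the notions below. -/
abbrev Tri : Type := Affine.Triangle ℝ Plane

/-- A triangle is oblique if none of its three angles is a right angle. -/
def IsOblique (T : Tri) : Prop :=
  ∀ i : Fin 3,
    EuclideanGeometry.angle (T.points (i + 1)) (T.points i) (T.points (i + 2)) ≠ Real.pi / 2

/-- Two triangles are similar as figures: similar for some matching of their corners. -/
def SimilarTri (S T : Tri) : Prop :=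
  ∃ σ : Equiv.Perm (Fin 3), Similar (S.points ∘ σ) T.points

/-- Two triangles are congruent as figures: congruent for some matching of their corners. -/
def CongruentTri (S T : Tri) : Prop :=
  ∃ σ : Equiv.Perm (Fin 3), Congruent (S.points ∘ σ) T.points

/-- The triangles `t i`, `i : Fin r`, subdivide `T`: together they cover exactly `T`, and no two
of them have a common interior point. -/
structure IsTiling (T : Tri) {r : ℕ} (t : Fin r → Tri) : Prop where
  covers : ⋃ i, (t i).closedInterior = T.closedInterior
  disjoint : ∀ i j, i ≠ j → Disjoint (t i).interior (t j).interior

/-- An `r`-gentiling of `T`: a subdivision of `T` into `r ≥ 2` tiles, each similar to `T`. -/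
structure IsGentiling (T : Tri) {r : ℕ} (t : Fin r → Tri) : Prop extends IsTiling T t where
  two_le : 2 ≤ r
  similar : ∀ i, SimilarTri (t i) T

/-- An `r`-reptiling of `T`: an `r`-gentiling all tiles of which are mutually congruent. -/
structure IsReptiling (T : Tri) {r : ℕ} (t : Fin r → Tri) : Prop extends IsGentiling T t where
  congruent : ∀ i j, CongruentTri (t i) (t j)

/-- The point `P + (i/n) (Q - P) + (j/n) (R - P)`, where `P, Q, R` are the corners of `T`. For
`i + j ≤ n` these are the intersection points in `T` of the lines which are parallel to the sides
of `T` and pass through the points that divide the sides into `n` segments of equal length. -/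
def gridPoint (T : Tri) (n i j : ℕ) : Plane :=
  T.points 0 + ((i : ℝ) / n) • (T.points 1 - T.points 0)
    + ((j : ℝ) / n) • (T.points 2 - T.points 0)

/-- The cells (as sets of points) of the trivial `n²`-reptiling of `T`, that is, the triangles into
which `T` is cut by all lines that are parallel to a side of `T` and pass through one of the points
that divide the sides of `T` into `n` segments of equal length: `n (n + 1) / 2` cells that are
translates of a scaled copy of `T`, and `n (n - 1) / 2` cells that are rotated by a half turn. -/
def gridCells (T : Tri) (n : ℕ) : Set (Set Plane) :=
  {S | ∃ i j : ℕ, i + j + 1 ≤ n ∧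
    S = convexHull ℝ {gridPoint T n i j, gridPoint T n (i + 1) j, gridPoint T n i (j + 1)}} ∪
  {S | ∃ i j : ℕ, i + j + 2 ≤ n ∧
    S = convexHull ℝ
      {gridPoint T n (i + 1) (j + 1), gridPoint T n (i + 1) j, gridPoint T n i (j + 1)}}

/-- The tiling `t` of `T` is the trivial `n²`-reptiling of `T` for some `n ≥ 1`. -/
def IsTrivialReptiling (T : Tri) {r : ℕ} (t : Fin r → Tri) : Prop :=
  ∃ n : ℕ, 1 ≤ n ∧ Set.range (fun i => (t i).closedInterior) = gridCells T n

/-- `v` is a corner of the triangle `S` (a corner-adjacency of `v` to `S`). -/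
def IsCorner (S : Tri) (v : Plane) : Prop := ∃ k, v = S.points k

/-- `v` lies on a side of the triangle `S`, but is not a corner of `S` (if `S` is a tile, this is an
edge-adjacency of `v` to `S`). -/
def OnSideInterior (S : Tri) (v : Plane) : Prop :=
  ∃ j k, j ≠ k ∧ Sbtw ℝ (S.points j) v (S.points k)

/-- The vertices of a tiling: all points that are a corner of at least one tile. -/
def IsVertex {r : ℕ} (t : Fin r → Tri) (v : Plane) : Prop := ∃ i, IsCorner (t i) v

/-- The half vertices of a tiling of `T`: the vertices that lie in the interior of a side of `T`, or
that have an edge-adjacency to exactly one tile. -/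
def IsHalfVertex (T : Tri) {r : ℕ} (t : Fin r → Tri) (v : Plane) : Prop :=
  IsVertex t v ∧ (OnSideInterior T v ∨ ∃! i, OnSideInterior (t i) v)

end Reptile

end

/-! Suppose that no half vertex lies inside `T`. Comparing solid angles shows that no corner of a
tile can lie in the relative interior of a side of another tile (`corner_of_mem`), so the tiling is
edge-to-edge. It then remains to show that every edge-to-edge tiling by equally scaled copies of an
oblique triangle is trivial (`EdgeTiling.range_eq_symCells`). This goes by induction on the number
of tiles: the tiling must contain the complete row of cells of a trivial tiling along some side of
`T` (`EdgeTiling.exists_row`), and removing this row leaves an edge-to-edge tiling of a smaller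
homothetic triangle (`EdgeTiling.peel`).

The row comes from two kinds of local information. The angles at a vertex add up to the solid angle
of `T` there (`EdgeTiling.sum_cnt_ang`). Moreover, each edge through the interior of `T` belongs to
exactly two tiles and each edge on the boundary to one; hence the number of tile sides of a given
length at an interior vertex is even (`EdgeTiling.even_flags`), and on a side of `T` an even number
forces a boundary edge to be continued by another one of the same length
(`EdgeTiling.exists_next_edge`).

In the scalene case and in the isosceles case with two largest angles, parity shows that the largest
angles are at no vertex more frequent than in a trivial tiling. Since their total number is fixed,
they are everywhere on the boundary exactly as frequent (`EdgeTiling.cnt_eq_of_le`). In the other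
two cases angle sums alone suffice. Obliqueness enters in `le_one_of_largest`: two right angles
would fill a straight angle. So the relevant vertices on a side have just three tiles, and starting
at a suitable corner of `T` the same edge repeats along the side, with a rotated tile in every gap
(`EdgeTiling.step`, `EdgeTiling.walk`). -/

namespace Reptile

open MeasureTheory Set

/-! ### Barycentric coordinates and the position of a point in a triangle. -/

/-- The corners of a triangle, as an affine basis of the plane. -/
noncomputable def Tri.basis (S : Tri) : AffineBasis (Fin 3) ℝ Plane :=
  ⟨S.points, S.independent, by
    rw [S.independent.affineSpan_eq_top_iff_card_eq_finrank_add_one]; simp⟩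

/-- The barycentric coordinates of a point with respect to a triangle. -/
noncomputable def bc (S : Tri) (k : Fin 3) : Plane →ᵃ[ℝ] ℝ := (Tri.basis S).coord k

lemma basis_apply (S : Tri) (k : Fin 3) : (Tri.basis S) k = S.points k := rfl

lemma coe_basis (S : Tri) : ⇑(Tri.basis S) = S.points := rfl

lemma bc_points (S : Tri) (k l : Fin 3) : bc S k (S.points l) = if k = l then 1 else 0 := by
  rw [← basis_apply, bc, AffineBasis.coord_apply]

@[simp] lemma bc_points_self (S : Tri) (k : Fin 3) : bc S k (S.points k) = 1 := by
  simp [bc_points]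

lemma bc_points_ne (S : Tri) {k l : Fin 3} (h : k ≠ l) : bc S k (S.points l) = 0 := by
  simp [bc_points, h]

lemma sum_bc (S : Tri) (x : Plane) : ∑ k, bc S k x = 1 := (Tri.basis S).sum_coord_apply_eq_one x

lemma sum_bc_smul (S : Tri) (x : Plane) : ∑ k, bc S k x • S.points k = x :=
  (Tri.basis S).linear_combination_coord_eq_self x

lemma bc_ext (S : Tri) {x y : Plane} (h : ∀ k, bc S k x = bc S k y) : x = y := by
  rw [← sum_bc_smul S x, ← sum_bc_smul S y]; simp [h]

lemma continuous_bc (S : Tri) (k : Fin 3) : Continuous (bc S k) :=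
  continuous_barycentric_coord (Tri.basis S) k

lemma bc_add (S : Tri) (k : Fin 3) (x v : Plane) :
    bc S k (x + v) = bc S k x + (bc S k).linear v := by
  have := (bc S k).map_vadd x v
  simpa [add_comm] using this

lemma bc_linear_sub (S : Tri) (k : Fin 3) (x y : Plane) :
    (bc S k).linear (x - y) = bc S k x - bc S k y := by
  have := bc_add S k y (x - y)
  rw [add_sub_cancel] at this
  linarith

lemma bc_comb (S : Tri) (k : Fin 3) (x y : Plane) (s : ℝ) :
    bc S k (x + s • (y - x)) = (1 - s) * bc S k x + s * bc S k y := by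
  rw [bc_add, map_smul, bc_linear_sub, smul_eq_mul]; ring

lemma bc_midpoint (S : Tri) (k : Fin 3) (x y : Plane) :
    bc S k (midpoint ℝ x y) = (bc S k x + bc S k y) / 2 := by
  have h : midpoint ℝ x y = x + (1 / 2 : ℝ) • (y - x) := by
    rw [midpoint_eq_smul_add, smul_sub, smul_add]
    have : (⅟2 : ℝ) = 1 / 2 := by norm_num
    rw [this]
    module
  rw [h, bc_comb]; ring

lemma closedInterior_eq_convexHull (S : Tri) :
    S.closedInterior = convexHull ℝ (range S.points) :=
  (Affine.Simplex.convexHull_eq_closedInterior S).symm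

lemma mem_closedInterior (S : Tri) (x : Plane) : x ∈ S.closedInterior ↔ ∀ k, 0 ≤ bc S k x := by
  rw [closedInterior_eq_convexHull, ← coe_basis, AffineBasis.convexHull_eq_nonneg_coord]; rfl

lemma mem_interior (S : Tri) (x : Plane) : x ∈ S.interior ↔ ∀ k, 0 < bc S k x := by
  have h1 : Finset.univ.affineCombination ℝ S.points (fun k => bc S k x) = x :=
    (Tri.basis S).affineCombination_coord_eq_self x
  conv_lhs => rw [← h1]
  rw [Affine.Simplex.affineCombination_mem_interior_iff (sum_bc S x)]
  constructor
  · intro h k; exact (h k).1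
  · intro h k
    refine ⟨h k, ?_⟩
    have h2 := sum_bc S x
    rw [Fin.sum_univ_three] at h2
    have := h 0; have := h 1; have := h 2
    fin_cases k <;> simp <;> linarith

lemma interior_closedInterior (S : Tri) : interior S.closedInterior = S.interior := by
  rw [closedInterior_eq_convexHull, ← coe_basis, AffineBasis.interior_convexHull]
  ext x; rw [mem_interior]; rfl

lemma isOpen_triInterior (S : Tri) : IsOpen S.interior := by
  rw [← interior_closedInterior]; exact isOpen_interior

lemma isClosed_triClosed (S : Tri) : IsClosed S.closedInterior :=
  Affine.Simplex.isClosed_closedInterior S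

lemma convex_closedInterior (S : Tri) : Convex ℝ S.closedInterior := by
  rw [closedInterior_eq_convexHull]; exact convex_convexHull _ _

lemma nonempty_triInterior (S : Tri) : S.interior.Nonempty := by
  rw [← interior_closedInterior, closedInterior_eq_convexHull, ← coe_basis]
  exact ⟨_, AffineBasis.centroid_mem_interior_convexHull (Tri.basis S)⟩

lemma closure_triInterior (S : Tri) : closure S.interior = S.closedInterior := by
  rw [← interior_closedInterior, (convex_closedInterior S).closure_interior_eq_closure_of_nonempty_interior,
    (isClosed_triClosed S).closure_eq]
  rw [interior_closedInterior]; exact nonempty_triInterior S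

lemma triInterior_subset (S : Tri) : S.interior ⊆ S.closedInterior :=
  Affine.Simplex.interior_subset_closedInterior S

lemma points_mem (S : Tri) (k : Fin 3) : S.points k ∈ S.closedInterior :=
  Affine.Simplex.point_mem_closedInterior S k

lemma points_ne (S : Tri) {k l : Fin 3} (h : k ≠ l) : S.points k ≠ S.points l :=
  fun h' => h (S.independent.injective h')

/-- The three labels of the corners of a triangle. -/
lemma fin3_cases {a b c : Fin 3} (hab : a ≠ b) (hac : a ≠ c) (hbc : b ≠ c) (k : Fin 3) :
    k = a ∨ k = b ∨ k = c := by
  revert a b c k; decide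

lemma sum_fin3 {M : Type*} [AddCommMonoid M] {a b c : Fin 3} (hab : a ≠ b) (hac : a ≠ c)
    (hbc : b ≠ c) (f : Fin 3 → M) : ∑ k, f k = f a + f b + f c := by
  have : (Finset.univ : Finset (Fin 3)) = {a, b, c} := by
    ext k; simpa using fin3_cases hab hac hbc k
  rw [this, Finset.sum_insert (by simp [hab, hac]), Finset.sum_insert (by simp [hbc]),
    Finset.sum_singleton, add_assoc]

lemma exists_third {a b : Fin 3} (hab : a ≠ b) : ∃ c, a ≠ c ∧ b ≠ c := by
  revert a b; decide

lemma exists_others (a : Fin 3) : ∃ b c, a ≠ b ∧ a ≠ c ∧ b ≠ c := by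
  revert a; decide

/-! ### Areas of circular sectors and half discs. -/

/-- In polar coordinates the set is the rectangle `0 < r < ε`, `0 ≤ θ ≤ A`: as `A < π`, the signs of
`sin θ` and `sin (θ - A)` cut out exactly these arguments. -/
lemma volume_sector_complex {A ε : ℝ} (hA : 0 < A) (hA' : A < Real.pi) (hε : 0 < ε) :
    volume.real {z : ℂ | 0 ≤ z.im ∧ (z * Complex.exp (-(A * Complex.I))).im ≤ 0 ∧ ‖z‖ < ε}
      = A / 2 * ε ^ 2 := by
  set D := {z : ℂ | 0 ≤ z.im ∧ (z * Complex.exp (-(A * Complex.I))).im ≤ 0 ∧ ‖z‖ < ε} with hD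
  have hDm : MeasurableSet D := by
    apply MeasurableSet.inter
    · exact (isClosed_le continuous_const Complex.continuous_im).measurableSet
    apply MeasurableSet.inter
    · exact (isClosed_le (Complex.continuous_im.comp (continuous_id.mul continuous_const))
        continuous_const).measurableSet
    · exact (isOpen_lt continuous_norm continuous_const).measurableSet
  have key : ∀ p ∈ polarCoord.target, (Complex.polarCoord.symm p ∈ D ↔
      p ∈ Ioo (0:ℝ) ε ×ˢ Icc 0 A) := by
    rintro ⟨r, θ⟩ hp
    rw [polarCoord_target] at hp
    obtain ⟨hr, hθ1, hθ2⟩ := hp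
    simp only [mem_Ioi] at hr
    have hz : Complex.polarCoord.symm (r, θ) = r * Complex.exp (θ * Complex.I) := by
      rw [Complex.polarCoord_symm_apply, Complex.exp_mul_I]; simp
    have h1 : (Complex.polarCoord.symm (r, θ)).im = r * Real.sin θ := by
      rw [hz, Complex.im_ofReal_mul, Complex.exp_ofReal_mul_I_im]
    have h2 : (Complex.polarCoord.symm (r, θ) * Complex.exp (-(A * Complex.I))).im
        = r * Real.sin (θ - A) := by
      rw [hz, mul_assoc, ← Complex.exp_add]
      have : (θ : ℂ) * Complex.I + -(A * Complex.I) = ((θ - A : ℝ) : ℂ) * Complex.I := by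
        push_cast; ring
      rw [this, Complex.im_ofReal_mul, Complex.exp_ofReal_mul_I_im]
    have h3 : ‖Complex.polarCoord.symm (r, θ)‖ = r := by
      rw [Complex.norm_polarCoord_symm, abs_of_pos hr]
    rw [hD, mem_ofPred_eq, h1, h2, h3, mem_prod, mem_Ioo, mem_Icc]
    constructor
    · rintro ⟨a, b, c⟩
      have a' : 0 ≤ Real.sin θ := by
        by_contra hc; push Not at hc; nlinarith
      have b' : Real.sin (θ - A) ≤ 0 := by
        by_contra hc; push Not at hc; nlinarith
      have t0 : 0 ≤ θ := by
        by_contra hc; push Not at hc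
        linarith [Real.sin_neg_of_neg_of_neg_pi_lt hc hθ1]
      refine ⟨⟨hr, c⟩, t0, ?_⟩
      by_contra hc; push Not at hc
      have := Real.sin_pos_of_pos_of_lt_pi (x := θ - A) (by linarith) (by linarith)
      linarith
    · rintro ⟨⟨_, c⟩, t0, t1⟩
      simp only at t0 t1
      refine ⟨mul_nonneg hr.le (Real.sin_nonneg_of_nonneg_of_le_pi t0 hθ2.le), ?_, c⟩
      exact mul_nonpos_of_nonneg_of_nonpos hr.le
        (Real.sin_nonpos_of_nonpos_of_neg_pi_le (by linarith) (by linarith))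
  have hsub : Ioo (0:ℝ) ε ×ˢ Icc 0 A ⊆ polarCoord.target := by
    rintro ⟨r, θ⟩ ⟨h1, h2⟩
    rw [polarCoord_target]
    exact ⟨h1.1, by linarith [h2.1, Real.pi_pos], by linarith [h2.2]⟩
  have e1 : volume.real D = ∫ z, D.indicator (fun _ => (1:ℝ)) z := by
    rw [integral_indicator hDm]; simp
  rw [e1, ← Complex.integral_comp_polarCoord_symm]
  have e2 : ∀ p ∈ polarCoord.target,
      p.1 • D.indicator (fun _ => (1:ℝ)) (Complex.polarCoord.symm p)
      = (Ioo (0:ℝ) ε ×ˢ Icc 0 A).indicator (fun p => p.1 * (fun _ => (1:ℝ)) p.2) p := by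
    intro p hp
    by_cases h : Complex.polarCoord.symm p ∈ D
    · rw [indicator_of_mem h, indicator_of_mem ((key p hp).1 h)]; simp
    · rw [indicator_of_notMem h, indicator_of_notMem (fun h' => h ((key p hp).2 h'))]; simp
  have hT : MeasurableSet polarCoord.target := polarCoord.open_target.measurableSet
  have hR : MeasurableSet (Ioo (0:ℝ) ε ×ˢ Icc 0 A) := measurableSet_Ioo.prod measurableSet_Icc
  rw [setIntegral_congr_fun hT e2, setIntegral_indicator hR, inter_eq_right.2 hsub,
    Measure.volume_eq_prod, setIntegral_prod_mul (fun r : ℝ => r) (fun _ : ℝ => (1:ℝ))]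
  have i1 : ∫ x in Ioo (0:ℝ) ε, x = ε ^ 2 / 2 := by
    rw [← integral_Ioc_eq_integral_Ioo, ← intervalIntegral.integral_of_le hε.le, integral_id]; ring
  rw [i1]
  simp [hA.le]
  ring

/-- A rotation brings `x` to the positive real axis; if `y` lands in the lower half plane,
conjugation corrects this. -/
lemma exists_isometry_complex {x y : Plane} (hx : x ≠ 0) (hy : ∀ s : ℝ, y ≠ s • x) :
    ∃ Φ : Plane ≃ₗᵢ[ℝ] ℂ, Φ x = (‖x‖ : ℂ) ∧ 0 < (Φ y).im := by
  have step : ∃ Φ : Plane ≃ₗᵢ[ℝ] ℂ, Φ x = (‖x‖ : ℂ) := by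
    let Φ₀ : Plane ≃ₗᵢ[ℝ] ℂ := Complex.orthonormalBasisOneI.repr.symm
    have hn : ‖Φ₀ x‖ = ‖x‖ := Φ₀.norm_map x
    have hx0 : (‖x‖ : ℂ) ≠ 0 := by simpa using hx
    have hc : Φ₀ x ≠ 0 := by simpa using hx
    obtain ⟨c, hc⟩ : ∃ c : Circle, (c : ℂ) * Φ₀ x = ‖x‖ := by
      refine ⟨⟨‖x‖ / Φ₀ x, ?_⟩, ?_⟩
      · simp [Submonoid.unitSphere, hn, hx]
      · simp [hc]
    exact ⟨Φ₀.trans (rotation c), by simpa using hc⟩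
  obtain ⟨Φ, hΦ⟩ := step
  have him : (Φ y).im ≠ 0 := by
    intro h
    have hx0 : ‖x‖ ≠ 0 := by simpa using hx
    apply hy ((Φ y).re / ‖x‖)
    apply Φ.injective
    rw [map_smul, hΦ]
    apply Complex.ext
    · simp [hx0]
    · simp [h]
  rcases lt_or_gt_of_ne him with h | h
  · exact ⟨Φ.trans Complex.conjLIE, by simp [hΦ], by simpa using h⟩
  · exact ⟨Φ, hΦ, h⟩

lemma volume_sector {x y : Plane} (hx : x ≠ 0) (hy : ∀ s : ℝ, y ≠ s • x)
    {L M : Plane →ₗ[ℝ] ℝ} (hz : ∀ z, z = L z • x + M z • y) {ε : ℝ} (hε : 0 < ε) :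
    volume.real ({z | 0 ≤ L z ∧ 0 ≤ M z} ∩ Metric.ball 0 ε)
      = InnerProductGeometry.angle x y / 2 * ε ^ 2 := by
  obtain ⟨Φ, hΦx, hΦy⟩ := exists_isometry_complex hx hy
  have hx0 : 0 < ‖x‖ := by simpa using hx
  have hy0 : y ≠ 0 := by have := hy 0; simpa using this
  have hy1 : 0 < ‖y‖ := by simpa using hy0
  set A := (Φ y).arg with hA
  have hA0 : 0 < A := by
    rcases (Complex.arg_nonneg_iff.2 hΦy.le).lt_or_eq with h | h
    · exact h
    · have := (Complex.arg_eq_zero_iff.1 h.symm).2; linarith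
  have hA1 : A < Real.pi := Complex.arg_lt_pi_iff.2 (Or.inr hΦy.ne')
  have hang : InnerProductGeometry.angle x y = A := by
    rw [← Φ.toLinearIsometry.angle_map x y]
    change InnerProductGeometry.angle (Φ x) (Φ y) = A
    have : Φ x = ‖x‖ • (1 : ℂ) := by rw [hΦx]; simp
    rw [this, InnerProductGeometry.angle_smul_left_of_pos _ _ hx0,
      Complex.angle_one_left (by simpa using hy0), abs_of_pos hA0]
  have hyexp : Φ y = ‖y‖ * Complex.exp (A * Complex.I) := by
    rw [hA, ← Φ.norm_map y, Complex.norm_mul_exp_arg_mul_I]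
  have hsin : 0 < Real.sin A := Real.sin_pos_of_pos_of_lt_pi hA0 hA1
  rw [hang, ← volume_sector_complex hA0 hA1 hε]
  have hmp := Φ.measurePreserving
  rw [measureReal_def, measureReal_def, ← hmp.measure_preimage_equiv (f := Φ.toHomeomorph.toMeasurableEquiv)]
  congr 2
  ext z
  have hΦz : Φ z = L z * ‖x‖ + M z * ‖y‖ * Complex.exp (A * Complex.I) := by
    conv_lhs => rw [hz z]
    rw [map_add, map_smul, map_smul, hΦx, hyexp]
    simp [mul_assoc]
  -- Both imaginary parts are a coordinate of `z` times a constant of known sign, because `sin A >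
  -- 0`; so the sign conditions on `L` and `M` are those that describe the complex sector.
  have e1 : (Φ z).im = M z * ‖y‖ * Real.sin A := by
    rw [hΦz, Complex.add_im]
    have : ((L z : ℂ) * ‖x‖).im = 0 := by rw [← Complex.ofReal_mul, Complex.ofReal_im]
    rw [this, ← Complex.ofReal_mul, Complex.im_ofReal_mul, Complex.exp_ofReal_mul_I_im]; ring
  have e2 : (Φ z * Complex.exp (-(A * Complex.I))).im = - (L z * ‖x‖ * Real.sin A) := by
    rw [hΦz, add_mul, mul_assoc ((M z : ℂ) * ‖y‖), ← Complex.exp_add, add_neg_cancel,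
      Complex.exp_zero, mul_one, Complex.add_im]
    have : ((M z : ℂ) * ‖y‖).im = 0 := by rw [← Complex.ofReal_mul, Complex.ofReal_im]
    rw [this, ← Complex.ofReal_mul, Complex.im_ofReal_mul, ← neg_mul, ← Complex.ofReal_neg,
      Complex.exp_ofReal_mul_I_im, Real.sin_neg]
    ring
  change _ ↔ (0 ≤ (Φ z).im ∧ (Φ z * Complex.exp (-(A * Complex.I))).im ≤ 0 ∧ ‖Φ z‖ < ε)
  rw [e1, e2, Φ.norm_map]
  simp only [mem_inter_iff, mem_ofPred_eq, mem_ball_zero_iff]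
  constructor
  · rintro ⟨⟨h1, h2⟩, h3⟩
    exact ⟨by positivity, by simpa using (by positivity : 0 ≤ L z * ‖x‖ * Real.sin A), h3⟩
  · rintro ⟨h2, h1, h3⟩
    refine ⟨⟨?_, ?_⟩, h3⟩
    · have : 0 ≤ L z * (‖x‖ * Real.sin A) := by linarith
      exact nonneg_of_mul_nonneg_left this (by positivity)
    · have : 0 ≤ M z * (‖y‖ * Real.sin A) := by linarith
      exact nonneg_of_mul_nonneg_left this (by positivity)

/-- The half disc and its reflection in the origin have equal area, cover the disc, and overlap only
in the null set `ker L`. -/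
lemma volume_halfDisc {L : Plane →ₗ[ℝ] ℝ} (hL : L ≠ 0) {ε : ℝ} (hε : 0 < ε) :
    volume.real ({z | 0 ≤ L z} ∩ Metric.ball 0 ε) = Real.pi / 2 * ε ^ 2 := by
  have hLc : Continuous L := L.continuous_of_finiteDimensional
  set H := {z | 0 ≤ L z} ∩ Metric.ball 0 ε with hH
  have hHm : MeasurableSet H :=
    (isClosed_le continuous_const hLc).measurableSet.inter Metric.isOpen_ball.measurableSet
  have hfin : ∀ X : Set Plane, X ⊆ Metric.ball 0 ε → volume X ≠ ⊤ := fun X hX =>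
    ((measure_mono hX).trans_lt measure_ball_lt_top).ne
  have hneg : volume.real (-H) = volume.real H := by
    rw [measureReal_def, Measure.measure_neg, measureReal_def]
  have hker : volume {z | L z = 0} = 0 := by
    have : {z | L z = 0} = (LinearMap.ker L : Set Plane) := by ext; simp
    rw [this]
    apply Measure.addHaar_submodule
    rwa [Ne, LinearMap.ker_eq_top]
  have hinter : volume.real (H ∩ -H) = 0 := by
    rw [measureReal_def, measure_mono_null (t := {z | L z = 0}) _ hker]; · simp
    rintro z ⟨⟨h1, _⟩, h2, _⟩
    simp only [mem_ofPred_eq, map_neg] at h1 h2 ⊢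
    linarith
  have hunion : H ∪ -H = Metric.ball 0 ε := by
    ext z
    simp only [hH, mem_union, mem_inter_iff, mem_neg, mem_ofPred_eq, map_neg, mem_ball_zero_iff,
      norm_neg]
    constructor
    · rintro (h | h) <;> exact h.2
    · intro h
      rcases le_total 0 (L z) with h' | h'
      · exact Or.inl ⟨h', h⟩
      · exact Or.inr ⟨by linarith, h⟩
  have hball : volume.real (Metric.ball (0 : Plane) ε) = Real.pi * ε ^ 2 := by
    rw [measureReal_def, EuclideanSpace.volume_ball_fin_two]
    simp [hε.le, Real.pi_pos.le, mul_comm]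
  have := measureReal_union_add_inter (μ := volume) (s := H) (t := -H) hHm.neg
    (hfin _ inter_subset_right) (by rw [Measure.measure_neg]; exact hfin _ inter_subset_right)
  rw [hunion, hinter, hball, hneg] at this
  linarith

/-! ### Solid angles of a triangle, defined through the area in small discs. -/

/-- The angle of a triangle at one of its corners. -/
noncomputable def ang (S : Tri) (k : Fin 3) : ℝ :=
  EuclideanGeometry.angle (S.points (k + 1)) (S.points k) (S.points (k + 2))

lemma ang_eq (S : Tri) {k a b : Fin 3} (hka : k ≠ a) (hkb : k ≠ b) (hab : a ≠ b) :
    ang S k = EuclideanGeometry.angle (S.points a) (S.points k) (S.points b) := by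
  have : (a = k + 1 ∧ b = k + 2) ∨ (a = k + 2 ∧ b = k + 1) := by revert k a b; decide
  rcases this with ⟨rfl, rfl⟩ | ⟨rfl, rfl⟩
  · rfl
  · rw [EuclideanGeometry.angle_comm]; rfl

/-- The set `X` has solid angle `θ` at `v`. -/
def HasDens (X : Set Plane) (v : Plane) (θ : ℝ) : Prop :=
  ∃ δ > 0, ∀ ε, 0 < ε → ε < δ → volume.real (X ∩ Metric.ball v ε) = θ / 2 * ε ^ 2

lemma HasDens.unique {X : Set Plane} {v : Plane} {θ θ' : ℝ} (h : HasDens X v θ)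
    (h' : HasDens X v θ') : θ = θ' := by
  obtain ⟨δ, hδ, h⟩ := h
  obtain ⟨δ', hδ', h'⟩ := h'
  have hm : 0 < min δ δ' / 2 := by positivity
  have l1 : min δ δ' / 2 < δ := by linarith [min_le_left δ δ']
  have l2 : min δ δ' / 2 < δ' := by linarith [min_le_right δ δ']
  have e := (h _ hm l1).symm.trans (h' _ hm l2)
  have : (min δ δ' / 2) ^ 2 ≠ 0 := by positivity
  have := mul_right_cancel₀ this e
  linarith

lemma HasDens.of_eventually_eq {X : Set Plane} {v : Plane} {θ : ℝ} (Y : Set Plane)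
    (h : ∃ δ > 0, ∀ ε, 0 < ε → ε < δ → X ∩ Metric.ball v ε = (fun x => x - v) ⁻¹' Y ∩ Metric.ball v ε)
    (hY : ∀ ε, 0 < ε → volume.real (Y ∩ Metric.ball 0 ε) = θ / 2 * ε ^ 2) : HasDens X v θ := by
  obtain ⟨δ, hδ, h⟩ := h
  refine ⟨δ, hδ, fun ε h0 h1 => ?_⟩
  rw [h ε h0 h1, ← hY ε h0]
  have : (fun x => x - v) ⁻¹' Y ∩ Metric.ball v ε = (fun x => x - v) ⁻¹' (Y ∩ Metric.ball 0 ε) := by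
    ext x; simp [dist_eq_norm]
  rw [this, measureReal_def, measureReal_def]
  congr 1
  exact (measurePreserving_sub_right volume v).measure_preimage_equiv
    (f := MeasurableEquiv.subRight v) _

/-- Near `v` only the inequalities that are equalities at `v` matter; the others stay strict by
continuity. So the triangle agrees locally with a cone. -/
lemma ball_inter_closedInterior (S : Tri) {v : Plane} (hv : v ∈ S.closedInterior) :
    ∃ δ > 0, ∀ ε, 0 < ε → ε < δ → S.closedInterior ∩ Metric.ball v ε
      = (fun x => x - v) ⁻¹' {z | ∀ k, bc S k v = 0 → 0 ≤ (bc S k).linear z} ∩ Metric.ball v ε := by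
  have : ∀ᶠ x in nhds v, ∀ k, bc S k v ≠ 0 → 0 < bc S k x := by
    rw [Filter.eventually_all]
    intro k
    by_cases h : bc S k v = 0
    · exact Filter.Eventually.of_forall fun x hx => absurd h hx
    · have h' : 0 < bc S k v := lt_of_le_of_ne ((mem_closedInterior S v).1 hv k) (Ne.symm h)
      filter_upwards [(continuous_bc S k).continuousAt.eventually (lt_mem_nhds h')] with x hx _ using hx
  obtain ⟨δ, hδ, h⟩ := Metric.eventually_nhds_iff.1 this
  refine ⟨δ, hδ, fun ε h0 h1 => ?_⟩
  ext x
  simp only [mem_inter_iff, mem_closedInterior, mem_preimage, mem_ofPred_eq, and_congr_left_iff,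
    Metric.mem_ball, bc_linear_sub]
  intro hx
  constructor
  · intro H k hk; rw [hk]; linarith [H k]
  · intro H k
    by_cases hk : bc S k v = 0
    · have := H k hk; linarith
    · exact (h (hx.trans h1) k hk).le

lemma bc_linear_ne_zero (S : Tri) (k : Fin 3) : (bc S k).linear ≠ 0 := by
  intro h
  obtain ⟨a, b, hka, _, _⟩ := exists_others k
  have := bc_linear_sub S k (S.points k) (S.points a)
  rw [h, bc_points_self, bc_points_ne S hka] at this
  simp at this

lemma volume_ball_real (v : Plane) {ε : ℝ} (hε : 0 < ε) :
    volume.real (Metric.ball v ε) = Real.pi * ε ^ 2 := by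
  rw [measureReal_def, EuclideanSpace.volume_ball_fin_two]
  simp [hε.le, Real.pi_pos.le, mul_comm]

lemma hasDens_interior (S : Tri) {v : Plane} (hv : v ∈ S.interior) :
    HasDens S.closedInterior v (2 * Real.pi) := by
  refine HasDens.of_eventually_eq _ (ball_inter_closedInterior S (triInterior_subset S hv)) ?_
  intro ε hε
  have : {z | ∀ k, bc S k v = 0 → 0 ≤ (bc S k).linear z} = univ := by
    ext z; simp only [mem_ofPred_eq, mem_univ, iff_true]
    intro k hk; exact absurd hk ((mem_interior S v).1 hv k).ne'
  rw [this, univ_inter, volume_ball_real _ hε]; ring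

lemma hasDens_outside (S : Tri) {v : Plane} (hv : v ∉ S.closedInterior) :
    HasDens S.closedInterior v 0 := by
  obtain ⟨δ, hδ, h⟩ := Metric.isOpen_iff.1 (isClosed_triClosed S).isOpen_compl v hv
  refine ⟨δ, hδ, fun ε h0 h1 => ?_⟩
  have : S.closedInterior ∩ Metric.ball v ε = ∅ := by
    ext x
    simp only [mem_inter_iff, mem_empty_iff_false, iff_false, not_and]
    intro hx hx'
    exact h (Metric.ball_subset_ball h1.le hx') hx
  simp [this]

/-- `v` lies in the relative interior of the side opposite to the corner `k`. -/
def OnSide (S : Tri) (k : Fin 3) (v : Plane) : Prop := bc S k v = 0 ∧ ∀ l, l ≠ k → 0 < bc S l v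

lemma OnSide.mem {S : Tri} {k : Fin 3} {v : Plane} (h : OnSide S k v) : v ∈ S.closedInterior := by
  rw [mem_closedInterior]
  intro l
  by_cases hl : l = k
  · rw [hl, h.1]
  · exact (h.2 l hl).le

lemma hasDens_side {S : Tri} {k : Fin 3} {v : Plane} (h : OnSide S k v) :
    HasDens S.closedInterior v Real.pi := by
  refine HasDens.of_eventually_eq _ (ball_inter_closedInterior S h.mem) ?_
  intro ε hε
  have : {z | ∀ k, bc S k v = 0 → 0 ≤ (bc S k).linear z} = {z | 0 ≤ (bc S k).linear z} := by
    ext z; simp only [mem_ofPred_eq]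
    constructor
    · intro H; exact H k h.1
    · intro H l hl
      by_cases hlk : l = k
      · rw [hlk]; exact H
      · exact absurd hl (h.2 l hlk).ne'
  rw [this, volume_halfDisc (bc_linear_ne_zero S k) hε]

lemma hasDens_corner (S : Tri) (k : Fin 3) :
    HasDens S.closedInterior (S.points k) (ang S k) := by
  refine HasDens.of_eventually_eq _ (ball_inter_closedInterior S (points_mem S k)) ?_
  intro ε hε
  obtain ⟨a, b, hka, hkb, hab⟩ := exists_others k
  have : {z | ∀ l, bc S l (S.points k) = 0 → 0 ≤ (bc S l).linear z}
      = {z | 0 ≤ (bc S a).linear z ∧ 0 ≤ (bc S b).linear z} := by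
    ext z; simp only [mem_ofPred_eq]
    constructor
    · intro H; exact ⟨H a (bc_points_ne S hka.symm), H b (bc_points_ne S hkb.symm)⟩
    · rintro ⟨h1, h2⟩ l hl
      rcases fin3_cases hka hkb hab l with rfl | rfl | rfl
      · simp at hl
      · exact h1
      · exact h2
  rw [this, ang_eq S hka hkb hab, EuclideanGeometry.angle]
  apply volume_sector _ _ _ hε
  · simpa [sub_eq_zero] using points_ne S hka.symm
  · intro s hs
    have := congrArg (bc S b).linear hs
    rw [map_smul] at this
    simp only [vsub_eq_sub, bc_linear_sub, bc_points_self, bc_points_ne S hkb.symm,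
      bc_points_ne S hab.symm] at this
    simp at this
  · intro z
    have h1 : z = (S.points k + z) - S.points k := by simp
    have h2 : ∀ l, (bc S l).linear z = bc S l (S.points k + z) - bc S l (S.points k) := by
      intro l; rw [← bc_linear_sub]; simp
    have h3 := sum_bc_smul S (S.points k + z)
    have h4 := sum_bc S (S.points k + z)
    rw [sum_fin3 hka hkb hab] at h3 h4
    rw [h2, h2, bc_points_ne S hka.symm, bc_points_ne S hkb.symm]
    have h5 : bc S k (S.points k + z) = 1 - bc S a (S.points k + z) - bc S b (S.points k + z) := by
      linarith
    rw [h5] at h3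
    have h6 : z = (S.points k + z) - S.points k := by simp
    rw [← h3] at h6
    conv_lhs => rw [h6]
    simp only [vsub_eq_sub]
    module

/-- The position of a point of a closed triangle. -/
lemma position (S : Tri) {v : Plane} (hv : v ∈ S.closedInterior) :
    v ∈ S.interior ∨ (∃ k, OnSide S k v) ∨ ∃ k, v = S.points k := by
  rw [mem_closedInterior] at hv
  by_cases h : ∀ k, bc S k v ≠ 0
  · left; rw [mem_interior]; exact fun k => lt_of_le_of_ne (hv k) (h k).symm
  right
  push Not at h
  obtain ⟨k, hk⟩ := h
  obtain ⟨a, b, hka, hkb, hab⟩ := exists_others k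
  have hs := sum_bc S v
  rw [sum_fin3 hka hkb hab, hk, zero_add] at hs
  have corner : ∀ {a b}, k ≠ a → k ≠ b → a ≠ b → bc S a v = 0 → bc S b v = 1 → v = S.points b := by
    intro a b hka hkb hab h1 h2
    apply bc_ext S
    intro l
    rcases fin3_cases hka hkb hab l with rfl | rfl | rfl
    · rw [hk, bc_points_ne S hkb]
    · rw [h1, bc_points_ne S hab]
    · rw [h2, bc_points_self]
  rcases (hv a).lt_or_eq with ha | ha
  · rcases (hv b).lt_or_eq with hb | hb
    · left
      refine ⟨k, hk, fun l hl => ?_⟩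
      rcases fin3_cases hka hkb hab l with rfl | rfl | rfl
      · exact absurd rfl hl
      · exact ha
      · exact hb
    · right; exact ⟨a, corner hkb hka hab.symm hb.symm (by linarith)⟩
  · right; exact ⟨b, corner hka hkb hab ha.symm (by linarith)⟩

lemma exists_hasDens (S : Tri) (v : Plane) : ∃ θ, HasDens S.closedInterior v θ := by
  by_cases hv : v ∈ S.closedInterior
  · rcases position S hv with h | ⟨k, h⟩ | ⟨k, rfl⟩
    · exact ⟨_, hasDens_interior S h⟩
    · exact ⟨_, hasDens_side h⟩
    · exact ⟨_, hasDens_corner S k⟩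
  · exact ⟨_, hasDens_outside S hv⟩

/-- The solid angle of a closed triangle at a point. -/
noncomputable def dens (S : Tri) (v : Plane) : ℝ := (exists_hasDens S v).choose

lemma hasDens_dens (S : Tri) (v : Plane) : HasDens S.closedInterior v (dens S v) :=
  (exists_hasDens S v).choose_spec

lemma dens_interior (S : Tri) {v : Plane} (hv : v ∈ S.interior) : dens S v = 2 * Real.pi :=
  (hasDens_dens S v).unique (hasDens_interior S hv)

lemma dens_outside (S : Tri) {v : Plane} (hv : v ∉ S.closedInterior) : dens S v = 0 :=
  (hasDens_dens S v).unique (hasDens_outside S hv)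

lemma dens_side {S : Tri} {k : Fin 3} {v : Plane} (h : OnSide S k v) : dens S v = Real.pi :=
  (hasDens_dens S v).unique (hasDens_side h)

lemma dens_corner (S : Tri) (k : Fin 3) : dens S (S.points k) = ang S k :=
  (hasDens_dens S _).unique (hasDens_corner S k)

lemma not_collinear (S : Tri) {k a b : Fin 3} (hka : k ≠ a) (hkb : k ≠ b) (hab : a ≠ b) :
    ¬ Collinear ℝ {S.points a, S.points k, S.points b} := by
  have : ({S.points a, S.points k, S.points b} : Set Plane) = range S.points := by
    ext x
    simp only [mem_insert_iff, mem_singleton_iff, mem_range]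
    constructor
    · rintro (h | h | h) <;> exact ⟨_, h.symm⟩
    · rintro ⟨l, rfl⟩
      rcases fin3_cases hka hkb hab l with rfl | rfl | rfl <;> simp
  rw [this]
  exact (affineIndependent_iff_not_collinear.1 S.independent)

lemma ang_pos (S : Tri) (k : Fin 3) : 0 < ang S k := by
  obtain ⟨a, b, hka, hkb, hab⟩ := exists_others k
  rw [ang_eq S hka hkb hab]
  refine lt_of_le_of_ne (EuclideanGeometry.angle_nonneg _ _ _) fun h => ?_
  exact not_collinear S hka hkb hab (EuclideanGeometry.collinear_of_angle_eq_zero h.symm)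

lemma sum_ang (S : Tri) : ∑ k, ang S k = Real.pi := by
  rw [Fin.sum_univ_three, ang_eq S (k := 0) (a := 2) (b := 1) (by decide) (by decide) (by decide),
    ang_eq S (k := 1) (a := 0) (b := 2) (by decide) (by decide) (by decide),
    ang_eq S (k := 2) (a := 1) (b := 0) (by decide) (by decide) (by decide)]
  have := EuclideanGeometry.angle_add_angle_add_angle_eq_pi (p₁ := S.points 0) (p₂ := S.points 1)
    (S.points 2) (points_ne S (by decide))
  linarith

lemma ang_lt_pi (S : Tri) (k : Fin 3) : ang S k < Real.pi := by
  obtain ⟨a, b, hka, hkb, hab⟩ := exists_others k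
  have := sum_ang S
  rw [sum_fin3 hka hkb hab] at this
  linarith [ang_pos S a, ang_pos S b]

lemma dens_nonneg (S : Tri) (v : Plane) : 0 ≤ dens S v := by
  by_cases hv : v ∈ S.closedInterior
  · rcases position S hv with h | ⟨k, h⟩ | ⟨k, rfl⟩
    · rw [dens_interior S h]; positivity
    · rw [dens_side h]; positivity
    · rw [dens_corner]; exact (ang_pos S k).le
  · rw [dens_outside S hv]

/-! ### Additivity of solid angles in a tiling. -/

set_option linter.unusedSectionVars false

variable {ι : Type*} [Fintype ι]

/-- A common point of the closed triangles lies on one of the two frontiers, and frontiers of convex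
sets are null sets. -/
lemma aedisjoint_of_disjoint_interior {S S' : Tri} (h : Disjoint S.interior S'.interior) :
    AEDisjoint volume S.closedInterior S'.closedInterior := by
  have h1 := (convex_closedInterior S).addHaar_frontier volume
  have h2 := (convex_closedInterior S').addHaar_frontier volume
  refine measure_mono_null ?_ (measure_union_null h1 h2)
  rintro x ⟨hx, hx'⟩
  by_cases hi : x ∈ S.interior
  · right
    rw [frontier, interior_closedInterior]
    exact ⟨subset_closure hx', fun h' => Set.disjoint_left.1 h hi h'⟩
  · left
    rw [frontier, interior_closedInterior]
    exact ⟨subset_closure hx, hi⟩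

/-- The solid angles of the tiles at a point add up to the solid angle of the tiled triangle. -/
lemma sum_dens {T : Tri} {t : ι → Tri} (hc : ⋃ i, (t i).closedInterior = T.closedInterior)
    (hd : ∀ i j, i ≠ j → Disjoint (t i).interior (t j).interior) (v : Plane) :
    ∑ i, dens (t i) v = dens T v := by
  apply HasDens.unique (X := T.closedInterior) (v := v) _ (hasDens_dens T v)
  choose δ hδ h using fun i => hasDens_dens (t i) v
  obtain ⟨δ', hδ', hle⟩ : ∃ δ' > 0, ∀ i, δ' ≤ δ i := by
    have := (Filter.eventually_all.2 fun i => Iio_mem_nhds (hδ i) : ∀ᶠ x in nhds (0:ℝ), ∀ i, x < δ i)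
    obtain ⟨x, hx, hx'⟩ := Metric.eventually_nhds_iff.1 this
    refine ⟨x / 2, by positivity, fun i => (hx' ?_ i).le⟩
    rw [Real.dist_eq, sub_zero, abs_of_pos] <;> linarith
  refine ⟨δ', hδ', fun ε h0 h1 => ?_⟩
  rw [← hc, iUnion_inter, measureReal_def, measure_iUnion₀]
  · rw [tsum_fintype, ENNReal.toReal_sum, Finset.sum_div, Finset.sum_mul]
    · refine Finset.sum_congr rfl fun i _ => ?_
      exact h i ε h0 (h1.trans_le (hle i))
    · intro i _
      exact ((measure_mono inter_subset_right).trans_lt measure_ball_lt_top).ne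
  · intro i j hij
    exact (aedisjoint_of_disjoint_interior (hd i j hij)).mono inter_subset_left inter_subset_left
  · intro i
    exact ((isClosed_triClosed (t i)).measurableSet.inter measurableSet_ball).nullMeasurableSet

/-- A closed triangle is the closure of its interior, so a neighbourhood of one of its points meets
this interior. -/
lemma eq_of_mem_interior {t : ι → Tri}
    (hd : ∀ i j, i ≠ j → Disjoint (t i).interior (t j).interior) {i j : ι} {v : Plane}
    (hi : v ∈ (t i).interior) (hj : v ∈ (t j).closedInterior) : i = j := by
  by_contra hij
  rw [← closure_triInterior] at hj
  obtain ⟨x, hx, hx'⟩ := mem_closure_iff.1 hj _ (isOpen_triInterior (t i)) hi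
  exact Set.disjoint_left.1 (hd i j hij) hx hx'

/-- By the law of cosines the cosine is a quotient of quadratic expressions in the distances, from
which `ρ ^ 2` cancels. -/
lemma angle_eq_of_dist_eq_mul {a b c a' b' c' : Plane} {ρ : ℝ} (hρ : 0 < ρ)
    (hab : dist a b = ρ * dist a' b') (hcb : dist c b = ρ * dist c' b')
    (hac : dist a c = ρ * dist a' c') :
    EuclideanGeometry.angle a b c = EuclideanGeometry.angle a' b' c' := by
  rw [EuclideanGeometry.angle, EuclideanGeometry.angle, InnerProductGeometry.angle,
    InnerProductGeometry.angle, real_inner_eq_norm_mul_self_add_norm_mul_self_sub_norm_sub_mul_self_div_two,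
    real_inner_eq_norm_mul_self_add_norm_mul_self_sub_norm_sub_mul_self_div_two]
  simp only [vsub_eq_sub, sub_sub_sub_cancel_right, ← dist_eq_norm, hab, hcb, hac]
  congr 1
  by_cases h : dist a' b' * dist c' b' = 0
  · have : ρ * dist a' b' * (ρ * dist c' b') = 0 := by
      calc _ = ρ * ρ * (dist a' b' * dist c' b') := by ring
        _ = 0 := by rw [h, mul_zero]
    rw [this, h, div_zero, div_zero]
  · have h1 : dist a' b' ≠ 0 := left_ne_zero_of_mul h
    have h2 : dist c' b' ≠ 0 := right_ne_zero_of_mul h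
    field_simp

/-! ### Edge-to-edge tilings: angle sums at vertices and tiles that share an edge. -/

/-- An edge-to-edge tiling of `T` whose tiles are copies of `T` scaled by `ρ`, with the corners
of the tiles labelled accordingly. -/
structure EdgeTiling (T : Tri) (t : ι → Tri) (ρ : ℝ) : Prop where
  covers : ⋃ i, (t i).closedInterior = T.closedInterior
  disjoint : ∀ i j, i ≠ j → Disjoint (t i).interior (t j).interior
  pos : 0 < ρ
  dist_eq : ∀ i k l, dist ((t i).points k) ((t i).points l) = ρ * dist (T.points k) (T.points l)
  edge : ∀ i j k, (t i).points k ∈ (t j).closedInterior → ∃ l, (t i).points k = (t j).points l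

/-- The number of tiles with corner `k` at `v`. -/
noncomputable def cnt (t : ι → Tri) (k : Fin 3) (v : Plane) : ℕ :=
  (Finset.univ.filter fun i => (t i).points k = v).card

namespace EdgeTiling

variable {T : Tri} {t : ι → Tri} {ρ : ℝ}

lemma ang_tile (h : EdgeTiling T t ρ) (i : ι) (k : Fin 3) : ang (t i) k = ang T k :=
  angle_eq_of_dist_eq_mul h.pos (h.dist_eq _ _ _) (h.dist_eq _ _ _) (h.dist_eq _ _ _)

lemma subset (h : EdgeTiling T t ρ) (i : ι) : (t i).closedInterior ⊆ T.closedInterior :=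
  h.covers ▸ subset_iUnion (fun i => (t i).closedInterior) i

lemma points_mem (h : EdgeTiling T t ρ) (i : ι) (k : Fin 3) :
    (t i).points k ∈ T.closedInterior := h.subset i (Reptile.points_mem _ _)

/-- A vertex of an edge-to-edge tiling is either a corner of the tile or outside of it; the sum has
at most one nonzero term. -/
lemma dens_tile_vertex (h : EdgeTiling T t ρ) {v : Plane} (hv : ∃ i k, (t i).points k = v) (j : ι) :
    dens (t j) v = ∑ k, if (t j).points k = v then ang T k else 0 := by
  obtain ⟨i, k, rfl⟩ := hv
  by_cases hm : (t i).points k ∈ (t j).closedInterior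
  · obtain ⟨l, hl⟩ := h.edge i j k hm
    rw [hl, dens_corner, h.ang_tile]
    rw [Finset.sum_eq_single l]
    · simp
    · intro b _ hb; rw [if_neg (points_ne _ hb)]
    · simp
  · rw [dens_outside _ hm, Finset.sum_eq_zero]
    intro l _
    rw [if_neg]
    intro h'; exact hm (h' ▸ Reptile.points_mem _ _)

/-- The angles of the tiles around a vertex. -/
lemma sum_cnt_ang (h : EdgeTiling T t ρ) {v : Plane} (hv : ∃ i k, (t i).points k = v) :
    ∑ k, (cnt t k v : ℝ) * ang T k = dens T v := by
  rw [← sum_dens h.covers h.disjoint v]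
  simp_rw [h.dens_tile_vertex hv]
  rw [Finset.sum_comm]
  refine Finset.sum_congr rfl fun k _ => ?_
  rw [← Finset.sum_filter, Finset.sum_const, nsmul_eq_mul, cnt]

/-- A point in the relative interior of an edge of a tile is not a vertex. -/
lemma not_corner_of_edge (h : EdgeTiling T t ρ) {i : ι} {a b c : Fin 3} (hca : c ≠ a) (hcb : c ≠ b)
    (hab : a ≠ b) {m : Plane} (hm : OnSide (t i) c m) (j : ι) (k : Fin 3) : m ≠ (t j).points k := by
  rintro rfl
  obtain ⟨l, hl⟩ := h.edge j i k hm.mem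
  rw [hl] at hm
  have h1 := hm.2 a hca.symm
  have h2 := hm.2 b hcb.symm
  rw [bc_points] at h1 h2
  split_ifs at h1 h2 with h3 h4
  · exact hab (h3.trans h4.symm)
  all_goals simp at h1 h2

lemma onSide_midpoint (S : Tri) {a b c : Fin 3} (hca : c ≠ a) (hcb : c ≠ b) (hab : a ≠ b) :
    OnSide S c (midpoint ℝ (S.points a) (S.points b)) := by
  refine ⟨?_, fun l hl => ?_⟩
  · rw [bc_midpoint, bc_points_ne S hca, bc_points_ne S hcb]; simp
  · rw [bc_midpoint]
    rcases fin3_cases hca hcb hab l with rfl | rfl | rfl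
    · exact absurd rfl hl
    · rw [bc_points_self, bc_points_ne S hab]; norm_num
    · rw [bc_points_self, bc_points_ne S hab.symm]; norm_num

/-- Two tiles that share a point in the relative interior of an edge of both of them have
collinear edges there. -/
lemma linear_eq_zero_of_common_side (h : EdgeTiling T t ρ) {i j : ι} (hij : i ≠ j) {c z : Fin 3}
    {m e : Plane} (hi : OnSide (t i) c m) (hj : OnSide (t j) z m) (he : (bc (t i) c).linear e = 0) :
    (bc (t j) z).linear e ≤ 0 := by
  by_contra hpos
  push Not at hpos
  -- A direction `e` along the side of tile `i` that points into tile `j`, tilted slightly by an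
  -- inward direction `d` of tile `i`, points into both tiles, which would then have a common
  -- interior point.
  obtain ⟨d, hd⟩ : ∃ d, 0 < (bc (t i) c).linear d := by
    refine ⟨(t i).points c - m, ?_⟩
    rw [bc_linear_sub, bc_points_self, hi.1]; norm_num
  have ev1 : ∀ᶠ s in nhds (0:ℝ), 0 < (bc (t j) z).linear (e + s • d) := by
    have : Continuous fun s : ℝ => (bc (t j) z).linear (e + s • d) :=
      (LinearMap.continuous_of_finiteDimensional _).comp (by fun_prop)
    exact this.continuousAt.eventually (lt_mem_nhds (by simpa using hpos))
  obtain ⟨s, hs0, hs⟩ : ∃ s : ℝ, 0 < s ∧ 0 < (bc (t j) z).linear (e + s • d) := by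
    obtain ⟨δ, hδ, h'⟩ := Metric.eventually_nhds_iff.1 ev1
    refine ⟨δ / 2, by positivity, h' ?_⟩
    rw [Real.dist_eq, sub_zero, abs_of_pos] <;> linarith
  set f := e + s • d with hf
  have hfi : 0 < (bc (t i) c).linear f := by
    rw [hf, map_add, map_smul, he, zero_add, smul_eq_mul]; positivity
  have side : ∀ (S : Tri) (c : Fin 3), OnSide S c m → 0 < (bc S c).linear f →
      ∀ᶠ r in nhdsWithin (0:ℝ) (Ioi 0), m + r • f ∈ S.interior := by
    intro S c hS hf
    have : ∀ k, ∀ᶠ r in nhdsWithin (0:ℝ) (Ioi 0), 0 < bc S k (m + r • f) := by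
      intro k
      by_cases hk : k = c
      · subst hk
        filter_upwards [self_mem_nhdsWithin] with r hr
        rw [bc_add, hS.1, zero_add, map_smul, smul_eq_mul]
        exact mul_pos hr hf
      · apply Filter.Eventually.filter_mono nhdsWithin_le_nhds
        have : Continuous fun r : ℝ => bc S k (m + r • f) :=
          (continuous_bc S k).comp (by fun_prop)
        exact this.continuousAt.eventually (lt_mem_nhds (by simpa using hS.2 k hk))
    filter_upwards [Filter.eventually_all.2 this] with r hr
    exact (mem_interior S _).2 hr
  obtain ⟨r, h1, h2⟩ := ((side _ c hi hfi).and (side _ z hj hs)).exists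
  exact Set.disjoint_left.1 (h.disjoint i j hij) h1 h2

/-- If a tile contains the midpoint of an edge of another tile, it has that edge. -/
lemma corner_of_midpoint_mem (h : EdgeTiling T t ρ) {i j : ι} {a b c : Fin 3} (hca : c ≠ a)
    (hcb : c ≠ b) (hab : a ≠ b)
    (hm : midpoint ℝ ((t i).points a) ((t i).points b) ∈ (t j).closedInterior) :
    ∃ k, (t i).points a = (t j).points k := by
  by_cases hij : i = j
  · subst hij; exact ⟨a, rfl⟩
  set m := midpoint ℝ ((t i).points a) ((t i).points b) with hmdef
  have hi : OnSide (t i) c m := onSide_midpoint (t i) hca hcb hab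
  rcases position (t j) hm with hj | ⟨z, hj⟩ | ⟨k, hk⟩
  · exact absurd (eq_of_mem_interior h.disjoint hj hi.mem).symm hij
  swap
  · exact absurd hk (h.not_corner_of_edge hca hcb hab hi j k)
  -- Both tiles have sides through `m` on the same line, so the corner `a` of tile `i` lies on the
  -- line of the side of tile `j`.
  have hez : bc (t j) z ((t i).points a) = 0 := by
    have e0 : ∀ e, (bc (t i) c).linear e = 0 → (bc (t j) z).linear e = 0 := by
      intro e he
      have h1 := h.linear_eq_zero_of_common_side hij hi hj he
      have h2 := h.linear_eq_zero_of_common_side hij hi hj (e := -e) (by rw [map_neg, he, neg_zero])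
      rw [map_neg] at h2
      linarith
    have := e0 ((t i).points a - m) (by rw [bc_linear_sub, hi.1, bc_points_ne _ hca, sub_zero])
    rw [bc_linear_sub, hj.1] at this
    linarith
  have hsum : ∀ x, bc (t j) z x = 0 → ∀ p q, z ≠ p → z ≠ q → p ≠ q →
      bc (t j) p x + bc (t j) q x = 1 := by
    intro x hx p q hp hq hpq
    have := sum_bc (t j) x
    rw [sum_fin3 hp hq hpq, hx] at this
    linarith
  apply h.edge i j a
  rw [mem_closedInterior]
  intro p
  by_cases hpz : p = z
  · rw [hpz, hez]
  by_contra hneg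
  push Not at hneg
  obtain ⟨q, hzq, hpq⟩ := exists_third (a := z) (b := p) (Ne.symm hpz)
  -- If `A` were outside tile `j`, the segment from `m` to `A` would leave this tile where
  -- coordinate `p` vanishes, at parameter `β / (β - γ) < 1`. That point is the corner `q` of tile
  -- `j`, in the relative interior of an edge of tile `i`.
  set A := (t i).points a with hA
  set β := bc (t j) p m with hβ
  set γ := bc (t j) p A with hγ
  have hβ0 : 0 < β := hj.2 p hpz
  have hden : 0 < β - γ := by linarith
  have hs0 : 0 < β / (β - γ) := by positivity
  have hs1 : β / (β - γ) < 1 := by rw [div_lt_one hden]; linarith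
  have hq : m + (β / (β - γ)) • (A - m) = (t j).points q := by
    have z0 : bc (t j) z (m + (β / (β - γ)) • (A - m)) = 0 := by
      rw [bc_comb, hj.1, hez]; ring
    have p0 : bc (t j) p (m + (β / (β - γ)) • (A - m)) = 0 := by
      rw [bc_comb, ← hβ, ← hγ]; field_simp; ring
    have q1 := hsum _ z0 p q (Ne.symm hpz) hzq hpq
    rw [p0] at q1
    apply bc_ext (t j)
    intro l
    rcases fin3_cases (Ne.symm hpz) hzq hpq l with rfl | rfl | rfl
    · rw [z0, bc_points_ne _ hzq]
    · rw [p0, bc_points_ne _ hpq]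
    · rw [bc_points_self]; linarith
  refine h.not_corner_of_edge hca hcb hab (i := i) (m := m + (β / (β - γ)) • (A - m)) ?_ j q hq
  refine ⟨?_, fun l hl => ?_⟩
  · rw [bc_comb, hi.1, hA, bc_points_ne _ hca]; ring
  · rw [bc_comb]
    have h1 := hi.2 l hl
    have h2 := (mem_closedInterior _ _).1 (Reptile.points_mem (t i) a) l
    have : 0 < (1 - β / (β - γ)) * bc (t i) l m := mul_pos (by linarith) h1
    have : 0 ≤ β / (β - γ) * bc (t i) l A := mul_nonneg hs0.le h2
    linarith

/-- The number of tiles that share a given edge. -/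
lemma card_edge (h : EdgeTiling T t ρ) {i : ι} {a b : Fin 3} (hab : a ≠ b) :
    ((Finset.univ.filter fun j => (∃ k, (t i).points a = (t j).points k) ∧
      ∃ k, (t i).points b = (t j).points k).card : ℝ) * Real.pi
      = dens T (midpoint ℝ ((t i).points a) ((t i).points b)) := by
  obtain ⟨c, hac, hbc⟩ := exists_third hab
  -- At the midpoint of the edge a tile has solid angle `π` if it has this edge, and otherwise `0`.
  rw [← sum_dens h.covers h.disjoint, ← nsmul_eq_mul, ← Finset.sum_const, Finset.sum_filter]
  refine Finset.sum_congr rfl fun j _ => ?_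
  split_ifs with hj
  · obtain ⟨⟨k, hk⟩, l, hl⟩ := hj
    have hkl : k ≠ l := by
      rintro rfl; exact points_ne (t i) hab (hk.trans hl.symm)
    obtain ⟨z, hkz, hlz⟩ := exists_third hkl
    rw [hk, hl, dens_side (onSide_midpoint (t j) hkz.symm hlz.symm hkl)]
  · rw [dens_outside]
    intro hm
    apply hj
    refine ⟨h.corner_of_midpoint_mem hac.symm hbc.symm hab hm, ?_⟩
    rw [midpoint_comm] at hm
    exact h.corner_of_midpoint_mem hbc.symm hac.symm hab.symm hm

end EdgeTiling

/-! ### Vectors relative to a side of a triangle. -/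

lemma eq_smul_add_smul (T : Tri) {a b c : Fin 3} (hab : a ≠ b) (hac : a ≠ c) (hbc : b ≠ c)
    (z : Plane) : z = (bc T b).linear z • (T.points b - T.points a)
      + (bc T c).linear z • (T.points c - T.points a) := by
  have h2 : ∀ l, (bc T l).linear z = bc T l (T.points a + z) - bc T l (T.points a) := by
    intro l; rw [← bc_linear_sub]; simp
  have h3 := sum_bc_smul T (T.points a + z)
  have h4 := sum_bc T (T.points a + z)
  rw [sum_fin3 hab hac hbc] at h3 h4
  rw [h2, h2, bc_points_ne T hab.symm, bc_points_ne T hac.symm]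
  have h5 : bc T a (T.points a + z) = 1 - bc T b (T.points a + z) - bc T c (T.points a + z) := by
    linarith
  rw [h5] at h3
  have h6 : z = (T.points a + z) - T.points a := by simp
  rw [← h3] at h6
  conv_lhs => rw [h6]
  module

lemma exists_smul_of_linear_eq_zero (T : Tri) (c : Fin 3) {p q : Plane}
    (hp : (bc T c).linear p = 0) (hp0 : p ≠ 0) (hq : (bc T c).linear q = 0) :
    ∃ s : ℝ, q = s • p := by
  obtain ⟨a, b, hca, hcb, hab⟩ := exists_others c
  have ep := eq_smul_add_smul T hab hca.symm hcb.symm p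
  have eq := eq_smul_add_smul T hab hca.symm hcb.symm q
  rw [hp, zero_smul, add_zero] at ep
  rw [hq, zero_smul, add_zero] at eq
  have hb : (bc T b).linear p ≠ 0 := by
    intro h; rw [h, zero_smul] at ep; exact hp0 ep
  refine ⟨(bc T b).linear q / (bc T b).linear p, ?_⟩
  calc q = _ := eq
    _ = ((bc T b).linear q / (bc T b).linear p) •
        ((bc T b).linear p • (T.points b - T.points a)) := by
          rw [smul_smul, div_mul_cancel₀ _ hb]
    _ = _ := by rw [← ep]

lemma eq_or_eq_neg_of_norm_eq (T : Tri) (c : Fin 3) {p q : Plane}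
    (hp : (bc T c).linear p = 0) (hq : (bc T c).linear q = 0) (h : ‖q‖ = ‖p‖) :
    q = p ∨ q = -p := by
  by_cases hp0 : p = 0
  · subst hp0; left; simpa using h
  obtain ⟨s, rfl⟩ := exists_smul_of_linear_eq_zero T c hp hp0 hq
  rw [norm_smul, Real.norm_eq_abs] at h
  have h1 : |s| = 1 := by
    have : ‖p‖ ≠ 0 := by simpa using hp0
    exact mul_right_cancel₀ this (by rw [h, one_mul])
  rcases (abs_eq zero_le_one).1 h1 with rfl | rfl
  · left; simp
  · right; simp

/-- A point of an open half plane is determined by its distances to two points of the boundary. -/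
lemma eq_of_norm_eq (T : Tri) (c : Fin 3) {u w x : Plane} (hu : (bc T c).linear u = 0)
    (hu0 : u ≠ 0) (hw : 0 < (bc T c).linear w) (hx : 0 < (bc T c).linear x) (h1 : ‖x‖ = ‖w‖)
    (h2 : ‖x - u‖ = ‖w - u‖) : x = w := by
  -- The vector `x - w` is orthogonal to `u` and to `x + w`. These two span the plane, since `u` is
  -- parallel to the side while `x + w` is not, so `x - w` is orthogonal to itself.
  have i1 : inner ℝ (x - w) u = 0 := by
    have e1 := norm_sub_sq_real x u
    have e2 := norm_sub_sq_real w u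
    rw [h1, h2] at e1
    rw [inner_sub_left]; linarith
  have i2 : inner ℝ (x - w) (x + w) = 0 := by
    rw [inner_sub_left, inner_add_right, inner_add_right, real_inner_self_eq_norm_sq,
      real_inner_self_eq_norm_sq, h1, real_inner_comm]; ring
  have hxw : 0 < (bc T c).linear (x + w) := by rw [map_add]; linarith
  set β := (bc T c).linear (x - w) / (bc T c).linear (x + w) with hβ
  obtain ⟨s, hs⟩ := exists_smul_of_linear_eq_zero T c hu hu0 (q := (x - w) - β • (x + w)) (by
    rw [map_sub, map_smul, smul_eq_mul, hβ, div_mul_cancel₀ _ hxw.ne', sub_self])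
  have hd : x - w = s • u + β • (x + w) := by rw [← hs]; abel
  have : inner ℝ (x - w) (x - w) = 0 := by
    rw [congrArg (inner ℝ (x - w)) hd, inner_add_right, inner_smul_right, inner_smul_right, i1, i2]
    simp
  rw [inner_self_eq_zero, sub_eq_zero] at this
  exact this

/-! ### Parity of the number of tile sides of a given length at a vertex. -/

open Classical in
/-- The pairs of a tile with a corner at `v` and a side of this tile of length `ℓ` that ends
at `v`. -/
noncomputable def flags (t : ι → Tri) (v : Plane) (ℓ : ℝ) : Finset (ι × Fin 3 × Fin 3) :=
  Finset.univ.filter fun f => (t f.1).points f.2.1 = v ∧ f.2.1 ≠ f.2.2 ∧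
    dist ((t f.1).points f.2.1) ((t f.1).points f.2.2) = ℓ

lemma mem_flags {t : ι → Tri} {v : Plane} {ℓ : ℝ} {f : ι × Fin 3 × Fin 3} :
    f ∈ flags t v ℓ ↔ (t f.1).points f.2.1 = v ∧ f.2.1 ≠ f.2.2 ∧
      dist ((t f.1).points f.2.1) ((t f.1).points f.2.2) = ℓ := by
  simp [flags]

namespace EdgeTiling

variable {T : Tri} {t : ι → Tri} {ρ : ℝ}

-- Side lengths depend on the labels only, so parity of flags becomes a condition on the numbers
-- `cnt t k v`.
open Classical in
lemma card_flags (h : EdgeTiling T t ρ) (v : Plane) (ℓ : ℝ) : (flags t v ℓ).card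
    = ∑ k, ∑ l, if k ≠ l ∧ ρ * dist (T.points k) (T.points l) = ℓ then cnt t k v else 0 := by
  rw [flags, Finset.card_filter, Fintype.sum_prod_type]
  simp_rw [Fintype.sum_prod_type]
  rw [Finset.sum_comm]
  refine Finset.sum_congr rfl fun k _ => ?_
  rw [Finset.sum_comm]
  refine Finset.sum_congr rfl fun l _ => ?_
  simp only [h.dist_eq]
  split_ifs with hkl
  · rw [cnt, Finset.card_filter]
    refine Finset.sum_congr rfl fun i _ => ?_
    simp [hkl]
  · refine Finset.sum_eq_zero fun i _ => ?_
    rw [if_neg]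
    exact fun h' => hkl h'.2

-- The flags from `v` to `x` correspond to the tiles that share the edge `v x`: two if its midpoint
-- is inside `T`, one if it is on a side.
open Classical in
lemma card_flags_fiber (h : EdgeTiling T t ρ) {v x : Plane} {ℓ : ℝ}
    (hx : ∃ f ∈ flags t v ℓ, (t f.1).points f.2.2 = x) :
    (((flags t v ℓ).filter fun f => (t f.1).points f.2.2 = x).card : ℝ) * Real.pi
      = dens T (midpoint ℝ v x) := by
  obtain ⟨⟨i, a, b⟩, hf, hfx⟩ := hx
  rw [mem_flags] at hf
  obtain ⟨hv, hab, hℓ⟩ := hf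
  simp only at hv hab hℓ hfx
  have := h.card_edge (i := i) hab
  rw [hv, hfx] at this
  rw [← this]
  congr 2
  apply Finset.card_bij (fun f _ => f.1)
  · rintro ⟨j, k, l⟩ hf
    simp only [Finset.mem_filter, mem_flags] at hf
    simp only [Finset.mem_filter, Finset.mem_univ, true_and]
    exact ⟨⟨k, hf.1.1.symm⟩, l, hf.2.symm⟩
  · rintro ⟨j, k, l⟩ hf ⟨j', k', l'⟩ hf' hjj
    simp only [Finset.mem_filter, mem_flags] at hf hf' hjj
    subst hjj
    have h1 := (t j).independent.injective (hf.1.1.trans hf'.1.1.symm)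
    have h2 := (t j).independent.injective (hf.2.trans hf'.2.symm)
    rw [h1, h2]
  · intro j hj
    simp only [Finset.mem_filter, Finset.mem_univ, true_and] at hj
    obtain ⟨⟨k, hk⟩, l, hl⟩ := hj
    refine ⟨(j, k, l), ?_, rfl⟩
    simp only [Finset.mem_filter, mem_flags]
    refine ⟨⟨hk.symm, ?_, ?_⟩, hl.symm⟩
    · rintro rfl
      exact points_ne (t i) hab (hv.trans (hk.trans (hl.symm.trans hfx.symm)))
    · rw [← hk, ← hl, ← hℓ, hv, hfx]

lemma midpoint_interior {T : Tri} {v x : Plane} (hv : v ∈ T.closedInterior)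
    (hx : x ∈ T.closedInterior) (h : ∀ k, bc T k v = 0 → bc T k x ≠ 0) :
    midpoint ℝ v x ∈ T.interior := by
  rw [mem_closedInterior] at hv hx
  rw [mem_interior]
  intro k
  rw [bc_midpoint]
  by_cases hk : bc T k v = 0
  · have := lt_of_le_of_ne (hx k) (h k hk).symm
    linarith
  · have := lt_of_le_of_ne (hv k) (Ne.symm hk)
    linarith [hx k]

lemma midpoint_onSide {T : Tri} {c : Fin 3} {v x : Plane} (hv : OnSide T c v)
    (hx : x ∈ T.closedInterior) (h : bc T c x = 0) : OnSide T c (midpoint ℝ v x) := by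
  rw [mem_closedInterior] at hx
  refine ⟨by rw [bc_midpoint, hv.1, h]; norm_num, fun l hl => ?_⟩
  rw [bc_midpoint]
  linarith [hx l, hv.2 l hl]

lemma card_eq_two {n : ℕ} {θ : ℝ} (h : (n : ℝ) * Real.pi = θ) (hθ : θ = 2 * Real.pi) : n = 2 := by
  rw [hθ] at h
  exact_mod_cast mul_right_cancel₀ Real.pi_ne_zero h

lemma card_eq_one {n : ℕ} {θ : ℝ} (h : (n : ℝ) * Real.pi = θ) (hθ : θ = Real.pi) : n = 1 := by
  have h' : (n : ℝ) = 1 := mul_right_cancel₀ Real.pi_ne_zero (by rw [h, hθ, one_mul])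
  exact_mod_cast h'

open Classical in
/-- The sides of length `ℓ` at an interior vertex are shared by pairs of tiles. -/
lemma even_flags (h : EdgeTiling T t ρ) {v : Plane} (hv : v ∈ T.interior) (ℓ : ℝ) :
    Even (flags t v ℓ).card := by
  rw [Finset.card_eq_sum_card_image (fun f => (t f.1).points f.2.2)]
  refine Finset.even_sum _ fun x hx => ?_
  obtain ⟨f, hf, hfx⟩ := Finset.mem_image.1 hx
  have h1 := h.card_flags_fiber ⟨f, hf, hfx⟩
  rw [card_eq_two h1]
  · exact even_two
  · apply dens_interior
    apply midpoint_interior (triInterior_subset _ hv) (hfx ▸ h.points_mem _ _)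
    intro k hk
    exact absurd hk ((mem_interior T v).1 hv k).ne'

open Classical in
/-- Next to a boundary edge of length `ℓ` there is another one, if the number of flags of length
`ℓ` is even. -/
lemma exists_next_edge (h : EdgeTiling T t ρ) {c : Fin 3} {v x₀ : Plane} (hv : OnSide T c v) {ℓ : ℝ}
    (he : Even (flags t v ℓ).card) (hx₀ : ∃ f ∈ flags t v ℓ, (t f.1).points f.2.2 = x₀)
    (hx₀c : bc T c x₀ = 0) :
    ∃ j k l, k ≠ l ∧ (t j).points k = v ∧ dist v ((t j).points l) = ℓ ∧
      bc T c ((t j).points l) = 0 ∧ (t j).points l ≠ x₀ := by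
  -- Otherwise every edge of length `ℓ` at `v` other than `v x₀` runs through the interior and
  -- carries two flags, while `v x₀` carries one, and the total is odd.
  by_contra hcon
  push Not at hcon
  rw [Finset.card_eq_sum_card_image (fun f => (t f.1).points f.2.2),
    ← Finset.add_sum_erase _ _ (Finset.mem_image.2 hx₀)] at he
  have h1 : ((flags t v ℓ).filter fun f => (t f.1).points f.2.2 = x₀).card = 1 := by
    apply card_eq_one (h.card_flags_fiber hx₀)
    obtain ⟨f, hf, rfl⟩ := hx₀
    exact dens_side (midpoint_onSide hv (h.points_mem _ _) hx₀c)
  have h2 : Even (∑ x ∈ ((flags t v ℓ).image fun f => (t f.1).points f.2.2).erase x₀,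
      ((flags t v ℓ).filter fun f => (t f.1).points f.2.2 = x).card) := by
    refine Finset.even_sum _ fun x hx => ?_
    rw [Finset.mem_erase] at hx
    obtain ⟨f, hf, hfx⟩ := Finset.mem_image.1 hx.2
    rw [card_eq_two (h.card_flags_fiber ⟨f, hf, hfx⟩)]
    · exact even_two
    apply dens_interior
    apply midpoint_interior hv.mem (hfx ▸ h.points_mem _ _)
    intro k hk
    have hkc : k = c := by
      by_contra hkc; exact (hv.2 k hkc).ne' hk
    subst hkc
    intro hxk
    rw [mem_flags] at hf
    refine hx.1 ?_
    rw [← hfx]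
    apply hcon f.1 f.2.1 f.2.2 hf.2.1 hf.1
    · rw [← hf.2.2, hf.1]
    · rw [hfx]; exact hxk
  rw [h1, Nat.even_add'] at he
  exact (Nat.not_odd_iff_even.2 h2) (he.1 odd_one)

end EdgeTiling

/-! ### Propagation of an edge pattern along a side of the triangle. -/

/-- There is a tile with corners `x, y, z`, the labels of `x` and `y` being related by `Pat`. -/
def Fits (t : ι → Tri) (Pat : Fin 3 → Fin 3 → Prop) (x y z : Plane) : Prop :=
  ∃ i a b c, a ≠ b ∧ a ≠ c ∧ b ≠ c ∧ Pat a b ∧ (t i).points a = x ∧ (t i).points b = y ∧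
    (t i).points c = z

lemma Fits.mono {t : ι → Tri} {Pat Pat' : Fin 3 → Fin 3 → Prop} {x y z : Plane}
    (h : Fits t Pat x y z) (hP : ∀ a b, Pat a b → Pat' a b) : Fits t Pat' x y z := by
  obtain ⟨i, a, b, c, h1, h2, h3, h4, h5⟩ := h
  exact ⟨i, a, b, c, h1, h2, h3, hP _ _ h4, h5⟩

/-- A set of pairs of labels that propagates along the sides of `T`: the edge that follows a
boundary edge labelled by `Pat` is labelled by `Pat` again. -/
structure GoodPattern (T : Tri) (t : ι → Tri) (ρ : ℝ) (Pat : Fin 3 → Fin 3 → Prop) : Prop where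
  same : ∀ {a b c a' b' c' : Fin 3}, a ≠ b → a ≠ c → b ≠ c → a' ≠ b' → a' ≠ c' → b' ≠ c' →
    Pat a b → Pat a' b' → dist (T.points a) (T.points b) = dist (T.points a') (T.points b') ∧
      dist (T.points a) (T.points c) = dist (T.points a') (T.points c') ∧
      dist (T.points b) (T.points c) = dist (T.points b') (T.points c')
  three : ∀ {v : Plane} {c : Fin 3}, OnSide T c v → ∀ {i a b}, a ≠ b → Pat a b →
    (t i).points b = v → ∑ k, cnt t k v = 3
  even : ∀ {v : Plane} {c : Fin 3}, OnSide T c v → ∀ {i a b}, a ≠ b → Pat a b →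
    (t i).points b = v → Even (flags t v (ρ * dist (T.points a) (T.points b))).card
  next : ∀ {v : Plane} {c : Fin 3}, OnSide T c v → ∀ {i a b}, a ≠ b → Pat a b →
    (t i).points b = v → ∀ {j a' b'}, j ≠ i → a' ≠ b' → (t j).points a' = v →
    dist (T.points a') (T.points b') = dist (T.points a) (T.points b) → Pat a' b'

open Classical in
lemma card_corner_le (t : ι → Tri) (v : Plane) :
    (Finset.univ.filter fun i => ∃ k, v = (t i).points k).card ≤ ∑ k, cnt t k v := by
  have : (Finset.univ.filter fun i => ∃ k, v = (t i).points k)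
      = Finset.univ.biUnion fun k => Finset.univ.filter fun i => (t i).points k = v := by
    ext i; simp [eq_comm]
  rw [this]
  refine Finset.card_biUnion_le.trans (le_of_eq (Finset.sum_congr rfl fun k _ => ?_))
  rw [cnt]

namespace EdgeTiling

variable {T : Tri} {t : ι → Tri} {ρ : ℝ}

/-- A third corner on the line of the side would make the linear part of `bc T c` vanish on two
independent vectors. -/
lemma bc_pos_of_side (h : EdgeTiling T t ρ) {c : Fin 3} {i : ι} {a b e : Fin 3} (hab : a ≠ b)
    (hae : a ≠ e) (hbe : b ≠ e) (ha : bc T c ((t i).points a) = 0)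
    (hb : bc T c ((t i).points b) = 0) : 0 < bc T c ((t i).points e) := by
  refine lt_of_le_of_ne ((mem_closedInterior T _).1 (h.points_mem i e) c) fun he => ?_
  apply bc_linear_ne_zero T c
  ext1 z
  rw [eq_smul_add_smul (t i) hab hae hbe z, map_add, map_smul, map_smul, bc_linear_sub,
    bc_linear_sub, ha, hb, ← he]
  simp

/-- Parity supplies the next boundary edge, of the same length; the pattern then fixes the shape of
its tile, a translate by `u` of the old one. As just three tiles meet at `v`, a single tile fills
the gap between the two, and it has an edge in common with each. -/
lemma step (h : EdgeTiling T t ρ) {Pat : Fin 3 → Fin 3 → Prop} (hP : GoodPattern T t ρ Pat)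
    {c : Fin 3} {v u w : Plane} (hv : OnSide T c v) (hu : (bc T c).linear u = 0)
    (hL : Fits t Pat (v - u) v (v - u + w)) :
    Fits t Pat v (v + u) (v + w) ∧ Fits t (fun _ _ => True) v (v + w - u) (v + w) := by
  classical
  obtain ⟨i, a, b, e, hab, hae, hbe, hpat, hia, hib, hie⟩ := hL
  have h0 : bc T c (v - u) = 0 := by
    have := bc_add T c (v - u) u
    rw [sub_add_cancel, hv.1, hu] at this; linarith
  have hiep : 0 < bc T c (v - u + w) := by
    rw [← hie]; exact h.bc_pos_of_side hab hae hbe (by rw [hia, h0]) (by rw [hib, hv.1])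
  have hw : 0 < (bc T c).linear w := by
    rw [bc_add, h0] at hiep; linarith
  have hu0 : u ≠ 0 := by
    rintro rfl
    exact points_ne (t i) hab (by rw [hia, hib, sub_zero])
  have hnu : ‖u‖ = ρ * dist (T.points a) (T.points b) := by
    rw [← h.dist_eq i, hia, hib, dist_eq_norm]
    rw [← norm_neg]; congr 1; abel
  have hnw : ‖w‖ = ρ * dist (T.points a) (T.points e) := by
    rw [← h.dist_eq i, hia, hie, dist_eq_norm]
    rw [← norm_neg]; congr 1; abel
  have hnwu : ‖w - u‖ = ρ * dist (T.points b) (T.points e) := by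
    rw [← h.dist_eq i, hib, hie, dist_eq_norm]
    rw [← norm_neg]; congr 1; abel
  obtain ⟨j, k, l, hkl, hjk, hjl, hjlc, hjl0⟩ := h.exists_next_edge (x₀ := v - u) hv
    (hP.even hv hab hpat hib) ⟨(i, b, a), by
      rw [mem_flags]
      exact ⟨hib, hab.symm, by rw [h.dist_eq, dist_comm]⟩, hia⟩ h0
  -- On the line of the side only `v + u` and `v - u` have the right distance from `v`, and `v - u`
  -- is the old endpoint.
  have hjl' : (t j).points l = v + u := by
    rcases eq_or_eq_neg_of_norm_eq T c (p := u) (q := (t j).points l - v) hu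
      (by rw [bc_linear_sub, hjlc, hv.1, sub_zero])
      (by rw [← dist_eq_norm, dist_comm, hjl, hnu]) with h' | h'
    · rw [← h']; abel
    · exact absurd (by rw [sub_eq_add_neg, ← h']; abel) hjl0
  have hji : j ≠ i := by
    rintro rfl
    have hkb : k = b := (t j).independent.injective (hjk.trans hib.symm)
    subst hkb
    rcases fin3_cases hab hae hbe l with rfl | rfl | rfl
    · exact hjl0 hia
    · exact hkl rfl
    · rw [← hie, hjlc] at hiep; exact lt_irrefl _ hiep
  have hdkl : dist (T.points k) (T.points l) = dist (T.points a) (T.points b) := by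
    have := h.dist_eq j k l
    rw [hjk, hjl] at this
    exact (mul_left_cancel₀ h.pos.ne' this).symm
  have hpat' : Pat k l := hP.next hv hab hpat hib hji hkl hjk hdkl
  obtain ⟨m, hkm, hlm⟩ := exists_third hkl
  obtain ⟨_, s2, s3⟩ := hP.same hab hae hbe hkl hkm hlm hpat hpat'
  have hjm : (t j).points m = v + w := by
    have hmp : 0 < bc T c ((t j).points m) :=
      h.bc_pos_of_side hkl hkm hlm (by rw [hjk, hv.1]) hjlc
    have := eq_of_norm_eq T c (u := u) (w := w) (x := (t j).points m - v) hu hu0 hw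
      (by rw [bc_linear_sub, hv.1]; linarith)
      (by rw [← dist_eq_norm, dist_comm, ← hjk, h.dist_eq, hnw, s2])
      (by
        have : (t j).points m - v - u = (t j).points m - (t j).points l := by rw [hjl']; abel
        rw [this, ← dist_eq_norm, dist_comm, h.dist_eq, hnwu, s3])
    rw [← this]; abel
  have hlin : ∀ z, (bc T c).linear z = 0 → w ≠ z := by
    rintro z hz rfl; exact hw.ne' hz
  refine ⟨⟨j, k, l, m, hkl, hkm, hlm, hpat', hjk, hjl', hjm⟩, ?_⟩
  -- An edge from `v` that leaves the side has its midpoint inside `T`, so there is a second tile on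
  -- it.
  have other : ∀ {i : ι} {p q : Fin 3}, p ≠ q → (t i).points p = v → 0 < bc T c ((t i).points q) →
      ∃ M, M ≠ i ∧ (∃ k, v = (t M).points k) ∧ ∃ k, (t i).points q = (t M).points k := by
    intro i p q hpq hp hq
    have hc := card_eq_two (h.card_edge (i := i) hpq) (by
      apply dens_interior
      rw [hp]
      apply midpoint_interior hv.mem (h.points_mem _ _)
      intro k hk
      have hkc : k = c := by
        by_contra hkc; exact (hv.2 k hkc).ne' hk
      subst hkc
      exact hq.ne')
    obtain ⟨M, hM, hMi⟩ := Finset.exists_mem_ne (by rw [hc]; norm_num) i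
    rw [Finset.mem_filter, hp] at hM
    exact ⟨M, hMi, hM.2⟩
  obtain ⟨M, hMi, ⟨k₁, hk₁⟩, k₂, hk₂⟩ := other hbe hib (by rw [hie]; exact hiep)
  obtain ⟨M', hMj, ⟨k₁', hk₁'⟩, k₃, hk₃⟩ := other hkm hjk (by
    rw [hjm, bc_add, hv.1]; linarith)
  rw [hie] at hk₂
  rw [hjm] at hk₃
  -- The corners of tile `j` are `v`, `v + u`, `v + w`. None of them is `v - u + w`, because `w` is
  -- not parallel to the side and `u ≠ 0`.
  have hMj' : M ≠ j := by
    rintro rfl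
    rcases fin3_cases hkl hkm hlm k₂ with rfl | rfl | rfl
    · rw [hjk] at hk₂
      exact hlin u hu (by rw [← sub_eq_zero] at hk₂ ⊢; rw [← hk₂]; abel)
    · rw [hjl'] at hk₂
      refine hlin (u + u) (by rw [map_add, hu]; simp) ?_
      rw [← sub_eq_zero] at hk₂ ⊢; rw [← hk₂]; abel
    · rw [hjm] at hk₂
      apply hu0
      rw [← sub_eq_zero] at hk₂; rw [← neg_eq_zero, ← hk₂]; abel
  have hMi' : M' ≠ i := by
    rintro rfl
    rcases fin3_cases hab hae hbe k₃ with rfl | rfl | rfl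
    · rw [hia] at hk₃
      refine hlin (-u) (by rw [map_neg, hu, neg_zero]) ?_
      rw [← sub_eq_zero] at hk₃ ⊢; rw [← hk₃]; abel
    · rw [hib] at hk₃
      exact hlin 0 (map_zero _) (by simpa using hk₃)
    · rw [hie] at hk₃
      apply hu0
      rw [← sub_eq_zero] at hk₃; rw [← hk₃]; abel
  -- Otherwise `i, j, M, M'` would be four tiles at a vertex that has only three.
  have hMM : M = M' := by
    by_contra hne
    have hsub : ({i, j, M, M'} : Finset ι) ⊆ Finset.univ.filter fun i => ∃ k, v = (t i).points k := by
      intro x hx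
      simp only [Finset.mem_insert, Finset.mem_singleton] at hx
      rw [Finset.mem_filter]
      refine ⟨Finset.mem_univ _, ?_⟩
      rcases hx with rfl | rfl | rfl | rfl
      · exact ⟨b, hib.symm⟩
      · exact ⟨k, hjk.symm⟩
      · exact ⟨k₁, hk₁⟩
      · exact ⟨k₁', hk₁'⟩
    have h4 : ({i, j, M, M'} : Finset ι).card = 4 := by
      rw [Finset.card_insert_of_notMem, Finset.card_insert_of_notMem,
        Finset.card_insert_of_notMem, Finset.card_singleton]
      · simpa using hne
      · simp [hMj'.symm, hMj.symm]
      · simp [hji.symm, hMi.symm, hMi'.symm]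
    have h5 := (Finset.card_le_card hsub).trans (card_corner_le t v)
    rw [hP.three hv hab hpat hib, h4] at h5
    norm_num at h5
  subst hMM
  refine ⟨M, k₁, k₂, k₃, ?_, ?_, ?_, trivial, hk₁.symm, ?_, hk₃.symm⟩
  · rintro rfl
    rw [← hk₁] at hk₂
    exact hlin u hu (by rw [← sub_eq_zero] at hk₂ ⊢; rw [← hk₂]; abel)
  · rintro rfl
    rw [← hk₁] at hk₃
    exact hlin 0 (map_zero _) (by simpa using hk₃)
  · rintro rfl
    rw [← hk₂] at hk₃
    apply hu0
    rw [← sub_eq_zero] at hk₃; rw [← hk₃]; abel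
  · rw [← hk₂]; abel

/-- If a corner of `T` lies in a single tile, then this tile has sides along both sides of `T`. -/
lemma corner_tile (h : EdgeTiling T t ρ) {a : Fin 3} (hone : ∑ k, cnt t k (T.points a) = 1)
    {i : ι} {k l m : Fin 3} (hkl : k ≠ l) (hkm : k ≠ m) (hlm : l ≠ m)
    (hik : (t i).points k = T.points a) :
    ∃ b c, a ≠ b ∧ a ≠ c ∧ b ≠ c ∧
      (∃ s : ℝ, 0 < s ∧ (t i).points l - T.points a = s • (T.points b - T.points a)) ∧
      ∃ s : ℝ, 0 < s ∧ (t i).points m - T.points a = s • (T.points c - T.points a) := by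
  classical
  -- An edge from the corner through the interior would belong to two tiles, but only one tile has a
  -- corner there.
  have key : ∀ l, k ≠ l → ∃ z, z ≠ a ∧ bc T z ((t i).points l) = 0 := by
    intro l hkl
    have hc := h.card_edge (i := i) hkl
    have hle : (Finset.univ.filter fun j => (∃ p, (t i).points k = (t j).points p) ∧
        ∃ p, (t i).points l = (t j).points p).card ≤ 1 := by
      refine (Finset.card_le_card ?_).trans ((card_corner_le t (T.points a)).trans hone.le)
      intro j hj
      rw [Finset.mem_filter] at hj ⊢
      rw [← hik]
      exact ⟨hj.1, hj.2.1⟩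
    have hnot : midpoint ℝ ((t i).points k) ((t i).points l) ∉ T.interior := by
      intro hin
      have := card_eq_two hc (dens_interior T hin)
      omega
    rw [mem_interior] at hnot
    push Not at hnot
    obtain ⟨z, hz⟩ := hnot
    rw [bc_midpoint, hik] at hz
    have h1 := (mem_closedInterior T _).1 (Reptile.points_mem T a) z
    have h2 := (mem_closedInterior T _).1 (h.points_mem i l) z
    refine ⟨z, ?_, by linarith⟩
    rintro rfl
    rw [bc_points_self] at hz
    linarith
  obtain ⟨c, hca, hc⟩ := key l hkl
  obtain ⟨b, hba, hb⟩ := key m hkm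
  have hbc : b ≠ c := by
    rintro rfl
    have := h.bc_pos_of_side hkl hkm hlm (by rw [hik, bc_points_ne T hba]) hc
    exact this.ne' hb
  have fin : ∀ l, k ≠ l → ∀ b c, a ≠ b → a ≠ c → b ≠ c → bc T c ((t i).points l) = 0 →
      ∃ s : ℝ, 0 < s ∧ (t i).points l - T.points a = s • (T.points b - T.points a) := by
    intro l hkl b c hab hac hbc hc
    have e := eq_smul_add_smul T hab hac hbc ((t i).points l - T.points a)
    rw [bc_linear_sub, bc_linear_sub, hc, bc_points_ne T hab.symm, bc_points_ne T hac.symm,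
      sub_zero, sub_zero, zero_smul, add_zero] at e
    refine ⟨_, lt_of_le_of_ne ((mem_closedInterior T _).1 (h.points_mem i l) b) ?_, e⟩
    intro h0
    rw [← h0, zero_smul, sub_eq_zero, ← hik] at e
    exact points_ne _ hkl e.symm
  exact ⟨b, c, hba.symm, hca.symm, hbc, fin l hkl b c hba.symm hca.symm hbc hc,
    fin m hkm c b hca.symm hba.symm hbc.symm hb⟩

/-- `step` applies as long as the end of the last edge lies strictly before `T.points b`, and an
edge cannot overshoot this corner because tiles stay inside `T`. So the edges end exactly at
`T.points b` and `1 / s` is an integer. -/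
lemma walk (h : EdgeTiling T t ρ) {Pat : Fin 3 → Fin 3 → Prop} (hP : GoodPattern T t ρ Pat)
    {a b c : Fin 3} (hab : a ≠ b) (hac : a ≠ c) (hbc : b ≠ c) {s : ℝ} (hs : 0 < s) {u w : Plane}
    (hu : u = s • (T.points b - T.points a))
    (hF : Fits t Pat (T.points a) (T.points a + u) (T.points a + w)) :
    ∃ n : ℕ, 1 ≤ n ∧ (n : ℝ) * s = 1 ∧
      (∀ i : ℕ, i < n → Fits t Pat (T.points a + (i : ℝ) • u) (T.points a + ((i : ℝ) + 1) • u)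
        (T.points a + (i : ℝ) • u + w)) ∧
      ∀ i : ℕ, i + 1 < n → Fits t (fun _ _ => True) (T.points a + ((i : ℝ) + 1) • u)
        (T.points a + (i : ℝ) • u + w) (T.points a + ((i : ℝ) + 1) • u + w) := by
  have hpos : ∀ (k : Fin 3) (r : ℝ), bc T k (T.points a + r • u)
      = (1 - r * s) * (if k = a then 1 else 0) + r * s * (if k = b then 1 else 0) := by
    intro k r
    rw [hu, smul_smul, bc_comb, bc_points, bc_points]
  -- The barycentric coordinate of the far endpoint at `a` is `1 - (i + 1) * s`, which is
  -- nonnegative in `T`.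
  have hle : ∀ i : ℕ, Fits t Pat (T.points a + (i : ℝ) • u) (T.points a + ((i : ℝ) + 1) • u)
        (T.points a + (i : ℝ) • u + w) → ((i : ℝ) + 1) * s ≤ 1 := by
    rintro i ⟨j, _, b', _, _, _, _, _, _, hj, _⟩
    have := (mem_closedInterior T _).1 (h.points_mem j b') a
    rw [hj, hpos] at this
    simp [hab] at this
    linarith
  have hulin : (bc T c).linear u = 0 := by
    rw [hu, map_smul, bc_linear_sub, bc_points_ne T hac.symm, bc_points_ne T hbc.symm]; simp
  have stepi : ∀ i : ℕ, ((i : ℝ) + 1) * s < 1 →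
      Fits t Pat (T.points a + (i : ℝ) • u) (T.points a + ((i : ℝ) + 1) • u)
        (T.points a + (i : ℝ) • u + w) →
      Fits t Pat (T.points a + ((i + 1 : ℕ) : ℝ) • u) (T.points a + (((i + 1 : ℕ) : ℝ) + 1) • u)
        (T.points a + ((i + 1 : ℕ) : ℝ) • u + w) ∧
      Fits t (fun _ _ => True) (T.points a + ((i : ℝ) + 1) • u)
        (T.points a + (i : ℝ) • u + w) (T.points a + ((i : ℝ) + 1) • u + w) := by
    intro i hi hf
    have hside : OnSide T c (T.points a + ((i : ℝ) + 1) • u) := by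
      refine ⟨?_, fun l hl => ?_⟩
      · rw [hpos]; simp [hac.symm, hbc.symm]
      · rw [hpos]
        rcases fin3_cases hab hac hbc l with rfl | rfl | rfl
        · simp [hab]; exact hi
        · simp [hab.symm]; positivity
        · exact absurd rfl hl
    have e1 : T.points a + ((i : ℝ) + 1) • u - u = T.points a + (i : ℝ) • u := by module
    have := h.step hP hside hulin (w := w) (by rw [e1]; exact hf)
    constructor
    · convert this.1 using 1
      · push_cast; rfl
      · push_cast; module
      · push_cast; rfl
    · convert this.2 using 1
      module
  have main : ∀ i : ℕ, (i : ℝ) * s < 1 →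
      Fits t Pat (T.points a + (i : ℝ) • u) (T.points a + ((i : ℝ) + 1) • u)
        (T.points a + (i : ℝ) • u + w) := by
    intro i
    induction i with
    | zero => intro _; simpa using hF
    | succ i ih =>
      intro hi
      push_cast at hi
      have := stepi i hi (ih (by nlinarith))
      exact this.1
  have hceil : 1 ≤ ⌈1 / s⌉₊ := Nat.one_le_iff_ne_zero.2 (Nat.ceil_pos.2 (by positivity)).ne'
  have hlt : ∀ i : ℕ, i < ⌈1 / s⌉₊ → (i : ℝ) * s < 1 := by
    intro i hi
    rw [Nat.lt_ceil, lt_div_iff₀ hs] at hi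
    exact hi
  refine ⟨⌈1 / s⌉₊, hceil, ?_, fun i hi => main i (hlt i hi), fun i hi => ?_⟩
  · apply le_antisymm
    · obtain ⟨n, hn⟩ := Nat.exists_eq_add_of_le' hceil
      have := hle n (main n (hlt n (by omega)))
      rw [hn]; push_cast; exact this
    · have := Nat.le_ceil (1 / s)
      rw [div_le_iff₀ hs] at this
      exact this
  · refine (stepi i ?_ (main i (hlt i (by omega)))).2
    have := hlt (i + 1) hi
    push_cast at this
    exact this

end EdgeTiling

/-! ### From a pattern to a complete row of cells. -/

/-- The tiles include the two-sided row of cells of the trivial tiling along a side of `T`. -/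
def HasRow (T : Tri) (t : ι → Tri) (ρ : ℝ) : Prop :=
  ∃ a b c : Fin 3, a ≠ b ∧ a ≠ c ∧ b ≠ c ∧ ∃ n : ℕ, 1 ≤ n ∧ (n : ℝ) * ρ = 1 ∧
    (∀ i : ℕ, i < n → Fits t (fun _ _ => True)
      (T.points a + (i : ℝ) • ρ • (T.points b - T.points a))
      (T.points a + ((i : ℝ) + 1) • ρ • (T.points b - T.points a))
      (T.points a + (i : ℝ) • ρ • (T.points b - T.points a) + ρ • (T.points c - T.points a))) ∧
    ∀ i : ℕ, i + 1 < n → Fits t (fun _ _ => True)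
      (T.points a + ((i : ℝ) + 1) • ρ • (T.points b - T.points a))
      (T.points a + (i : ℝ) • ρ • (T.points b - T.points a) + ρ • (T.points c - T.points a))
      (T.points a + ((i : ℝ) + 1) • ρ • (T.points b - T.points a)
        + ρ • (T.points c - T.points a))

lemma one_le_cnt {t : ι → Tri} {i : ι} {k : Fin 3} {v : Plane} (h : (t i).points k = v) :
    1 ≤ cnt t k v :=
  Finset.card_pos.2 ⟨i, by simp [h]⟩

lemma two_le_cnt {t : ι → Tri} {i j : ι} (hij : j ≠ i) {k : Fin 3} {v : Plane}
    (h : (t i).points k = v) (h' : (t j).points k = v) : 2 ≤ cnt t k v :=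
  Finset.one_lt_card.2 ⟨i, by simp [h], j, by simp [h'], hij.symm⟩

lemma ang_lt_iff (T : Tri) {a b c : Fin 3} (hab : a ≠ b) (hac : a ≠ c) (hbc : b ≠ c) :
    ang T a < ang T b ↔ dist (T.points b) (T.points c) < dist (T.points a) (T.points c) := by
  rw [ang_eq T hac hab hbc.symm, ang_eq T hbc hab.symm hac.symm,
    EuclideanGeometry.angle_lt_iff_dist_lt (not_collinear T hbc hab.symm hac.symm),
    dist_comm (T.points c), dist_comm (T.points c)]

lemma ang_eq_iff (T : Tri) {a b c : Fin 3} (hab : a ≠ b) (hac : a ≠ c) (hbc : b ≠ c) :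
    ang T a = ang T b ↔ dist (T.points b) (T.points c) = dist (T.points a) (T.points c) := by
  have h1 := ang_lt_iff T hab hac hbc
  have h2 := ang_lt_iff T hab.symm hbc hac
  constructor
  · intro h
    rw [h, lt_self_iff_false, false_iff, not_lt] at h1
    rw [h, lt_self_iff_false, false_iff, not_lt] at h2
    exact le_antisymm h2 h1
  · intro h
    rw [h, lt_self_iff_false, iff_false, not_lt] at h1
    rw [h, lt_self_iff_false, iff_false, not_lt] at h2
    exact le_antisymm h2 h1

namespace EdgeTiling

variable {T : Tri} {t : ι → Tri} {ρ : ℝ}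

lemma dens_le (h : EdgeTiling T t ρ) (j : ι) (v : Plane) : dens (t j) v ≤ dens T v := by
  rw [← sum_dens h.covers h.disjoint v]
  exact Finset.single_le_sum (f := fun i => dens (t i) v) (fun i _ => dens_nonneg _ _)
    (Finset.mem_univ j)

/-- The angle of `T` at its corner is less than `π`, too small for a tile that has this point in its
interior or inside a side. -/
lemma exists_corner (h : EdgeTiling T t ρ) (a : Fin 3) : ∃ i k, (t i).points k = T.points a := by
  have hm := Reptile.points_mem T a
  rw [← h.covers, mem_iUnion] at hm
  obtain ⟨i, hi⟩ := hm
  have hle := h.dens_le i (T.points a)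
  rw [dens_corner] at hle
  have hpi := ang_lt_pi T a
  rcases position (t i) hi with h' | ⟨k, h'⟩ | ⟨k, h'⟩
  · rw [dens_interior _ h'] at hle; linarith [Real.pi_pos]
  · rw [dens_side h'] at hle; linarith
  · exact ⟨i, k, h'.symm⟩

/-- A good pattern that starts at a corner of `T` yields a row of cells of the trivial tiling. -/
lemma hasRow (h : EdgeTiling T t ρ) {Pat : Fin 3 → Fin 3 → Prop} (hP : GoodPattern T t ρ Pat)
    (a : Fin 3) (hone : ∑ k, cnt t k (T.points a) = 1)
    (hstart : ∀ {i k}, (t i).points k = T.points a → ∃ l, k ≠ l ∧ Pat k l)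
    (hend : ∀ {b c}, a ≠ b → a ≠ c → b ≠ c → ∀ {a' b' c'}, a' ≠ b' → a' ≠ c' → b' ≠ c' →
      Pat a' b' → ang T b' ≤ ang T b →
        dist (T.points a') (T.points b') = dist (T.points a) (T.points b) ∧
        dist (T.points a') (T.points c') = dist (T.points a) (T.points c)) :
    HasRow T t ρ := by
  obtain ⟨i, k, hik⟩ := h.exists_corner a
  obtain ⟨l, hkl, hpat⟩ := hstart hik
  obtain ⟨m, hkm, hlm⟩ := exists_third hkl
  obtain ⟨b, c, hab, hac, hbc, ⟨s, hs, hl⟩, s', hs', hm⟩ := h.corner_tile hone hkl hkm hlm hik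
  obtain ⟨n, hn, hns, hF, hG⟩ := h.walk hP hab hac hbc hs hl (w := (t i).points m - T.points a)
    ⟨i, k, l, m, hkl, hkm, hlm, hpat, hik, by abel, by abel⟩
  -- The last edge, with index `n - 1`, ends at `T.points b`, so the angle of its tile there fits
  -- into the angle of `T`. By `hend` this identifies the tile's sides with those of `T`, whence
  -- both ratios `s` and `s'` equal `ρ`.
  have hang : ∃ a' b' c', a' ≠ b' ∧ a' ≠ c' ∧ b' ≠ c' ∧ Pat a' b' ∧ ang T b' ≤ ang T b := by
    obtain ⟨j, a', b', c', h1, h2, h3, h4, _, h5, _⟩ := hF (n - 1) (by omega)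
    refine ⟨a', b', c', h1, h2, h3, h4, ?_⟩
    have hjb : (t j).points b' = T.points b := by
      rw [h5, hl, Nat.cast_sub hn, Nat.cast_one, sub_add_cancel, smul_smul, hns]
      module
    have := h.dens_le j (T.points b)
    rw [← hjb, dens_corner, hjb, dens_corner, h.ang_tile] at this
    exact this
  obtain ⟨a', b', c', h1, h2, h3, h4, h5⟩ := hang
  obtain ⟨e1, e2⟩ := hend hab hac hbc h1 h2 h3 h4 h5
  obtain ⟨f1, f2, _⟩ := hP.same hkl hkm hlm h1 h2 h3 hpat h4
  have scale : ∀ {l b : Fin 3} {s : ℝ}, a ≠ b → 0 < s →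
      (t i).points l - T.points a = s • (T.points b - T.points a) →
      dist (T.points k) (T.points l) = dist (T.points a) (T.points b) → s = ρ := by
    intro l b s hab hs hl hd
    have e := congrArg norm hl
    rw [norm_smul, Real.norm_of_nonneg hs.le, ← hik, ← dist_eq_norm, dist_comm, h.dist_eq, hd,
      hik, ← dist_eq_norm, dist_comm (T.points b)] at e
    exact (mul_right_cancel₀ (dist_ne_zero.2 (points_ne T hab)) e).symm
  have hsρ := scale hab hs hl (f1.trans e1)
  have hsρ' := scale hac hs' hm (f2.trans e2)
  subst hsρ
  subst hsρ'
  rw [hl, hm] at hF hG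
  exact ⟨a, b, c, hab, hac, hbc, n, hn, hns, fun i hi => (hF i hi).mono fun _ _ _ => trivial, hG⟩

/-! ### Global count of the largest angles. -/

open Classical in
lemma sum_cnt_eq (t : ι → Tri) (k : Fin 3) :
    ∑ v ∈ Finset.univ.image (fun f : ι × Fin 3 => (t f.1).points f.2), cnt t k v
      = Fintype.card ι := by
  rw [← Finset.card_univ]
  refine (Finset.card_eq_sum_card_fiberwise ?_).symm
  intro i _
  exact Finset.mem_coe.2 (Finset.mem_image.2 ⟨(i, k), Finset.mem_univ _, rfl⟩)

/-- If the corners with labels in `W` are nowhere more frequent than in the trivial tiling, then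
they are everywhere on the boundary as frequent as in the trivial tiling. -/
lemma cnt_eq_of_le (h : EdgeTiling T t ρ) (W : Finset (Fin 3))
    (hint : ∀ v ∈ T.interior, (∃ i k, (t i).points k = v) → ∑ k ∈ W, cnt t k v ≤ 2 * W.card)
    (hside : ∀ v c, OnSide T c v → (∃ i k, (t i).points k = v) → ∑ k ∈ W, cnt t k v ≤ W.card)
    (hcorner : ∀ a, ∑ k ∈ W, cnt t k (T.points a) ≤ if a ∈ W then 1 else 0) :
    (∀ v c, OnSide T c v → (∃ i k, (t i).points k = v) → ∑ k ∈ W, cnt t k v = W.card) ∧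
    ∀ a, ∑ k ∈ W, cnt t k (T.points a) = if a ∈ W then 1 else 0 := by
  classical
  set V := Finset.univ.image (fun f : ι × Fin 3 => (t f.1).points f.2) with hV
  have hVmem : ∀ v, v ∈ V ↔ ∃ i k, (t i).points k = v := by
    intro v; simp [hV]
  set κ : ℝ := ((W.card : ℕ) : ℝ) with hκ
  -- `g` is the count expected in a trivial tiling: `2 * κ` inside, `κ` on a side, and `1` or `0` at
  -- a corner. The correction terms at the corners have sum zero because the angles of `T` add up to
  -- `π`.
  set g : Plane → ℝ := fun v => κ / Real.pi * dens T v
    + ∑ k, if v = T.points k then (if k ∈ W then 1 else 0) - κ / Real.pi * ang T k else 0 with hg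
  have hpi := Real.pi_pos
  have gnot : ∀ v, (∀ k, v ≠ T.points k) → g v = κ / Real.pi * dens T v := by
    intro v hv
    rw [hg]; simp [hv]
  have gint : ∀ v ∈ T.interior, g v = 2 * κ := by
    intro v hv
    rw [gnot, dens_interior _ hv]
    · field_simp
    · rintro k rfl
      have := dens_interior _ hv
      rw [dens_corner] at this
      linarith [ang_lt_pi T k]
  have gside : ∀ v c, OnSide T c v → g v = κ := by
    intro v c hv
    rw [gnot, dens_side hv]
    · field_simp
    · rintro k rfl
      have := dens_side hv
      rw [dens_corner] at this
      linarith [ang_lt_pi T k]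
  have gcorner : ∀ a, g (T.points a) = if a ∈ W then 1 else 0 := by
    intro a
    rw [hg]
    simp only
    rw [Finset.sum_eq_single a, if_pos rfl, dens_corner]
    · ring
    · intro b _ hb; rw [if_neg (points_ne T hb.symm)]
    · simp
  have hle : ∀ v ∈ V, ((∑ k ∈ W, cnt t k v : ℕ) : ℝ) ≤ g v := by
    intro v hv
    rw [hVmem] at hv
    have hvT : v ∈ T.closedInterior := by
      obtain ⟨i, k, rfl⟩ := hv; exact h.points_mem i k
    rcases position T hvT with h' | ⟨c, h'⟩ | ⟨a, rfl⟩
    · rw [gint v h', hκ]; exact_mod_cast hint v h' hv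
    · rw [gside v c h', hκ]; exact_mod_cast hside v c h' hv
    · rw [gcorner a]; exact_mod_cast hcorner a
  have hdens : ∑ v ∈ V, dens T v = Fintype.card ι * Real.pi := by
    have : ∀ v ∈ V, dens T v = ∑ k, (cnt t k v : ℝ) * ang T k := fun v hv =>
      (h.sum_cnt_ang ((hVmem v).1 hv)).symm
    rw [Finset.sum_congr rfl this, Finset.sum_comm]
    simp_rw [← Finset.sum_mul]
    rw [← sum_ang T, Finset.mul_sum]
    refine Finset.sum_congr rfl fun k _ => ?_
    rw [← sum_cnt_eq t k]
    push_cast; rfl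
  have hcard : ∑ k, ((if k ∈ W then (1:ℝ) else 0)) = κ := by
    rw [hκ]; simp
  -- Each tile contributes `κ` corners with labels in `W` and total angle `π`, so both sums are `κ`
  -- times the number of tiles; the termwise bound `hle` must then be an equality.
  have hsum : ∑ v ∈ V, ((∑ k ∈ W, cnt t k v : ℕ) : ℝ) = ∑ v ∈ V, g v := by
    have l : ∑ v ∈ V, ((∑ k ∈ W, cnt t k v : ℕ) : ℝ) = κ * Fintype.card ι := by
      rw [← Nat.cast_sum, Finset.sum_comm]
      simp_rw [hV, sum_cnt_eq]
      simp [hκ]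
    have r : ∑ v ∈ V, g v = κ * Fintype.card ι := by
      rw [hg, Finset.sum_add_distrib, ← Finset.mul_sum, hdens, Finset.sum_comm]
      have : ∀ k, ∑ v ∈ V, (if v = T.points k then
          (if k ∈ W then (1:ℝ) else 0) - κ / Real.pi * ang T k else 0)
          = (if k ∈ W then 1 else 0) - κ / Real.pi * ang T k := by
        intro k
        rw [Finset.sum_ite_eq', if_pos ((hVmem _).2 (h.exists_corner k))]
      simp_rw [this]
      rw [Finset.sum_sub_distrib, ← Finset.mul_sum, sum_ang, hcard]
      field_simp
      ring
    rw [l, r]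
  have heq := (Finset.sum_eq_sum_iff_of_le hle).1 hsum
  refine ⟨fun v c hv hvt => ?_, fun a => ?_⟩
  · have := heq v ((hVmem v).2 hvt)
    rw [gside v c hv, hκ] at this
    exact_mod_cast this
  · have := heq _ ((hVmem _).2 (h.exists_corner a))
    rw [gcorner a] at this
    exact_mod_cast this

end EdgeTiling

/-- Around a boundary vertex of the tiling of an oblique triangle, the largest angle occurs at
most once. -/
lemma le_one_of_largest {A B C : ℝ} {p q s : ℕ} (hA : 0 < A) (hAB : A ≤ B) (hBC : B < C)
    (hC : C ≠ Real.pi / 2) (hsum : A + B + C = Real.pi)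
    (h : p * A + q * B + s * C = Real.pi) : s ≤ 1 := by
  by_contra hs
  have hs2 : (2:ℝ) ≤ s := by exact_mod_cast (not_le.1 hs)
  have hp0 : (0:ℝ) ≤ p := Nat.cast_nonneg p
  have hq0 : (0:ℝ) ≤ q := Nat.cast_nonneg q
  have hsC : 2 * C ≤ s * C := mul_le_mul_of_nonneg_right hs2 (by linarith)
  have hpA : 0 ≤ p * A := mul_nonneg hp0 hA.le
  have hqB : 0 ≤ q * B := mul_nonneg hq0 (by linarith)
  -- Two angles `C` and one more angle exceed `A + B + C`, as `C > B`; so only angles `C` occur. Two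
  -- of them are excluded by obliqueness, and three exceed `π`.
  rcases Nat.eq_zero_or_pos p with rfl | hp
  swap
  · have : (1:ℝ) ≤ p := by exact_mod_cast hp
    have := mul_le_mul_of_nonneg_right this hA.le
    linarith
  rcases Nat.eq_zero_or_pos q with rfl | hq
  swap
  · have : (1:ℝ) ≤ q := by exact_mod_cast hq
    have := mul_le_mul_of_nonneg_right this (by linarith : 0 ≤ B)
    linarith
  simp only [Nat.cast_zero, zero_mul, zero_add] at h
  rcases Nat.lt_or_ge s 3 with h3 | h3
  · have : s = 2 := by omega
    subst this
    apply hC; push_cast at h; linarith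
  · have : (3:ℝ) ≤ s := by exact_mod_cast h3
    have := mul_le_mul_of_nonneg_right this (by linarith : 0 ≤ C)
    linarith

/-! ### Existence of a row, by the shape of the triangle. -/

lemma sum_three_ang (T : Tri) : ang T 0 + ang T 1 + ang T 2 = Real.pi := by
  rw [← sum_ang T, Fin.sum_univ_three]

/-- A multiple of a positive angle that is bounded by another angle. -/
lemma lt_of_mul_lt {n m : ℕ} {A X : ℝ} (hA : 0 < A) (h : n * A ≤ X) (hX : X < m * A) : n < m := by
  have : (n:ℝ) < m := lt_of_mul_lt_mul_right (h.trans_lt hX) hA.le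
  exact_mod_cast this

namespace EdgeTiling

variable {T : Tri} {t : ι → Tri} {ρ : ℝ}

open Classical in
lemma card_flags_mul (h : EdgeTiling T t ρ) (v : Plane) (d : ℝ) : (flags t v (ρ * d)).card
    = ∑ k, ∑ l, if k ≠ l ∧ dist (T.points k) (T.points l) = d then cnt t k v else 0 := by
  rw [h.card_flags]
  simp only [mul_right_inj' h.pos.ne']

lemma dens_onSide (h : EdgeTiling T t ρ) {v : Plane} {c : Fin 3} (hv : OnSide T c v)
    (hvt : ∃ i k, (t i).points k = v) :
    (cnt t 0 v : ℝ) * ang T 0 + cnt t 1 v * ang T 1 + cnt t 2 v * ang T 2 = Real.pi := by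
  rw [← dens_side hv, ← h.sum_cnt_ang hvt, Fin.sum_univ_three]

lemma dens_inside (h : EdgeTiling T t ρ) {v : Plane} (hv : v ∈ T.interior)
    (hvt : ∃ i k, (t i).points k = v) :
    (cnt t 0 v : ℝ) * ang T 0 + cnt t 1 v * ang T 1 + cnt t 2 v * ang T 2 = 2 * Real.pi := by
  rw [← dens_interior T hv, ← h.sum_cnt_ang hvt, Fin.sum_univ_three]

lemma dens_at_corner (h : EdgeTiling T t ρ) (a : Fin 3) :
    (cnt t 0 (T.points a) : ℝ) * ang T 0 + cnt t 1 (T.points a) * ang T 1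
      + cnt t 2 (T.points a) * ang T 2 = ang T a := by
  rw [← dens_corner T a, ← h.sum_cnt_ang (h.exists_corner a), Fin.sum_univ_three]

/-- All edges are alike and each corner at a vertex carries two flags, so every pair of labels
belongs to the pattern and no global count is needed. -/
lemma hasRow_equilateral (h : EdgeTiling T t ρ) (h01 : ang T 0 = ang T 1) (h12 : ang T 1 = ang T 2) :
    HasRow T t ρ := by
  have hs := sum_three_ang T
  have hA := ang_pos T 0
  have d1 : dist (T.points 1) (T.points 2) = dist (T.points 0) (T.points 2) :=
    (ang_eq_iff T (by decide) (by decide) (by decide)).1 h01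
  have d2 : dist (T.points 2) (T.points 0) = dist (T.points 1) (T.points 0) :=
    (ang_eq_iff T (by decide) (by decide) (by decide)).1 h12
  have e20 := dist_comm (T.points 2) (T.points 0)
  have e10 := dist_comm (T.points 1) (T.points 0)
  have e21 := dist_comm (T.points 2) (T.points 1)
  have hd : ∀ a b a' b' : Fin 3, a ≠ b → a' ≠ b' →
      dist (T.points a) (T.points b) = dist (T.points a') (T.points b') := by
    have : ∀ a b : Fin 3, a ≠ b →
        dist (T.points a) (T.points b) = dist (T.points 0) (T.points 1) := by
      intro a b hab
      fin_cases a <;> fin_cases b <;> simp at hab ⊢ <;> linarith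
    intro a b a' b' hab hab'
    rw [this a b hab, this a' b' hab']
  have total : ∀ {v : Plane} {n : ℕ}, (cnt t 0 v : ℝ) * ang T 0 + cnt t 1 v * ang T 1
      + cnt t 2 v * ang T 2 = n * ang T 0 → ∑ k, cnt t k v = n := by
    intro v n hn
    rw [← h12, ← h01, ← add_mul, ← add_mul] at hn
    rw [Fin.sum_univ_three]
    exact_mod_cast mul_right_cancel₀ hA.ne' hn
  have three : ∀ {v : Plane} {c : Fin 3}, OnSide T c v → (∃ i k, (t i).points k = v) →
      ∑ k, cnt t k v = 3 := by
    intro v c hv hvt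
    apply total
    rw [h.dens_onSide hv hvt]
    push_cast; linarith
  apply h.hasRow (Pat := fun _ _ => True) (a := 0)
  · refine ⟨?_, ?_, ?_, ?_⟩
    · intro a b c a' b' c' h1 h2 h3 h1' h2' h3' _ _
      exact ⟨hd _ _ _ _ h1 h1', hd _ _ _ _ h2 h2', hd _ _ _ _ h3 h3'⟩
    · intro v c hv i a b _ _ hib
      exact three hv ⟨i, b, hib⟩
    · intro v c hv i a b hab _ hib
      rw [h.card_flags_mul]
      have : ∀ k l : Fin 3, (k ≠ l ∧ dist (T.points k) (T.points l)
          = dist (T.points a) (T.points b)) ↔ k ≠ l :=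
        fun k l => ⟨fun h => h.1, fun h => ⟨h, hd _ _ _ _ h hab⟩⟩
      simp_rw [this]
      have e : ∑ k : Fin 3, ∑ l : Fin 3, (if k ≠ l then cnt t k v else 0)
          = 2 * ∑ k, cnt t k v := by
        simp [Fin.sum_univ_three]; ring
      rw [e]
      exact even_two_mul _
    · intros; trivial
  · apply total
    rw [h.dens_at_corner]; simp
  · intro i k _
    obtain ⟨l, _, hl, _⟩ := exists_others k
    exact ⟨l, hl, trivial⟩
  · intro b c h1 h2 h3 a' b' c' h1' h2' h3' _ _
    exact ⟨hd _ _ _ _ h1' h1, hd _ _ _ _ h2' h2⟩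

/-- The pattern consists of legs traversed towards the apex, label `2`. A vertex on a side with an
apex angle has, by `le_one_of_largest`, exactly one of them and two base angles. So the next leg
starts at a base corner and again leads to an apex. -/
lemma hasRow_small_base (h : EdgeTiling T t ρ) (h01 : ang T 0 = ang T 1) (h12 : ang T 1 < ang T 2)
    (hob : ang T 2 ≠ Real.pi / 2) : HasRow T t ρ := by
  have hs := sum_three_ang T
  have hA := ang_pos T 0
  have d1 : dist (T.points 1) (T.points 2) = dist (T.points 0) (T.points 2) :=
    (ang_eq_iff T (by decide) (by decide) (by decide)).1 h01
  have d2 : dist (T.points 2) (T.points 0) < dist (T.points 1) (T.points 0) :=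
    (ang_lt_iff T (by decide) (by decide) (by decide)).1 h12
  have e20 := dist_comm (T.points 2) (T.points 0)
  have e10 := dist_comm (T.points 1) (T.points 0)
  have e21 := dist_comm (T.points 2) (T.points 1)
  have side : ∀ {v : Plane} {c : Fin 3}, OnSide T c v → ∀ {i}, (t i).points 2 = v →
      cnt t 2 v = 1 ∧ cnt t 0 v + cnt t 1 v = 2 := by
    intro v c hv i hi
    have hd := h.dens_onSide hv ⟨i, 2, hi⟩
    have h1 := le_one_of_largest hA h01.le h12 hob hs hd
    have h2 := one_le_cnt hi
    have h3 : cnt t 2 v = 1 := le_antisymm h1 h2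
    refine ⟨h3, ?_⟩
    rw [h3, ← h01] at hd
    have : ((cnt t 0 v : ℝ) + cnt t 1 v) * ang T 0 = 2 * ang T 0 := by push_cast at hd; linarith
    exact_mod_cast mul_right_cancel₀ hA.ne' this
  have pat : ∀ a : Fin 3, a ≠ 2 → dist (T.points a) (T.points 2) = dist (T.points 0) (T.points 2) := by
    intro a ha
    fin_cases a <;> simp at ha ⊢
    exact d1
  have pat' : ∀ a c : Fin 3, a ≠ 2 → c ≠ 2 → a ≠ c →
      dist (T.points a) (T.points c) = dist (T.points 0) (T.points 1) := by
    intro a c ha hc hac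
    fin_cases a <;> fin_cases c <;> simp at ha hc hac ⊢
    exact e10
  have corner0 : cnt t 2 (T.points 0) = 0 ∧ cnt t 0 (T.points 0) + cnt t 1 (T.points 0) = 1 := by
    have hd := h.dens_at_corner 0
    have hn0 : (0:ℝ) ≤ cnt t 0 (T.points 0) * ang T 0 := by positivity
    have hn1 : (0:ℝ) ≤ cnt t 1 (T.points 0) * ang T 1 := by
      have := ang_pos T 1; positivity
    have h2 : cnt t 2 (T.points 0) < 1 := by
      apply lt_of_mul_lt (ang_pos T 2) (X := ang T 0) (by linarith)
      push_cast; linarith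
    have h2' : cnt t 2 (T.points 0) = 0 := by omega
    refine ⟨h2', ?_⟩
    rw [h2', ← h01] at hd
    have : ((cnt t 0 (T.points 0) : ℝ) + cnt t 1 (T.points 0)) * ang T 0 = 1 * ang T 0 := by
      push_cast at hd; linarith
    exact_mod_cast mul_right_cancel₀ hA.ne' this
  apply h.hasRow (Pat := fun _ b => b = 2) (a := 0)
  · refine ⟨?_, ?_, ?_, ?_⟩
    · rintro a b c a' b' c' h1 h2 h3 h1' h2' h3' rfl rfl
      refine ⟨?_, ?_, ?_⟩
      · rw [pat _ h1, pat _ h1']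
      · rw [pat' _ _ h1 h3.symm h2, pat' _ _ h1' h3'.symm h2']
      · rw [dist_comm, pat _ h3.symm, dist_comm (T.points 2), pat _ h3'.symm]
    · rintro v c hv i a b _ rfl hib
      obtain ⟨s1, s2⟩ := side hv hib
      rw [Fin.sum_univ_three]; omega
    · rintro v c hv i a b hab rfl hib
      obtain ⟨s1, s2⟩ := side hv hib
      rw [h.card_flags_mul, pat _ hab]
      have f1 : ¬ dist (T.points 0) (T.points 1) = dist (T.points 0) (T.points 2) := by
        intro h'; linarith
      have f2 : ¬ dist (T.points 1) (T.points 0) = dist (T.points 0) (T.points 2) := by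
        intro h'; linarith
      simp [Fin.sum_univ_three, f1, f2, d1, e20, e21, s1]
      -- The apex carries two flags of leg length and each of the two base corners one: four in all.
      exact ⟨2, by omega⟩
    · rintro v c hv i a b hab rfl hib j a' b' hji hab' hja hd
      by_contra hb
      have ha2 : a' ≠ 2 := by
        rintro rfl
        have := two_le_cnt hji hib hja
        have := (side hv hib).1
        omega
      rw [pat' _ _ ha2 hb hab', pat _ hab] at hd
      linarith
  · rw [Fin.sum_univ_three]; omega
  · intro i k hik
    refine ⟨2, ?_, rfl⟩
    rintro rfl
    have := one_le_cnt hik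
    omega
  · rintro b c h1 h2 h3 a' b' c' h1' h2' h3' rfl hle
    have hb : b = 2 := by
      by_contra hb
      have : b = 1 := by revert h1 hb; clear * -; revert b; decide
      subst this; linarith
    subst hb
    have hc : c = 1 := by revert h2 h3; clear * -; revert c; decide
    subst hc
    exact ⟨pat _ h1', pat' _ _ h1' h3'.symm h2'⟩

/-- The pattern consists of the base edges, and the corners `1` and `2` are counted together. Since
`3 * ang T 1 > π`, at most five of them meet at an interior vertex; each carries one base flag, so
by parity at most four do. The global count then gives two of them and one apex at each vertex on a
side. -/
lemma hasRow_large_base (h : EdgeTiling T t ρ) (h01 : ang T 0 < ang T 1) (h12 : ang T 1 = ang T 2) :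
    HasRow T t ρ := by
  have hs := sum_three_ang T
  have hA := ang_pos T 0
  have hB := ang_pos T 1
  have d1 : dist (T.points 1) (T.points 2) < dist (T.points 0) (T.points 2) :=
    (ang_lt_iff T (by decide) (by decide) (by decide)).1 h01
  have d2 : dist (T.points 2) (T.points 0) = dist (T.points 1) (T.points 0) :=
    (ang_eq_iff T (by decide) (by decide) (by decide)).1 h12
  have e20 := dist_comm (T.points 2) (T.points 0)
  have e10 := dist_comm (T.points 1) (T.points 0)
  have e21 := dist_comm (T.points 2) (T.points 1)
  have flag : ∀ v, (flags t v (ρ * dist (T.points 1) (T.points 2))).card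
      = cnt t 1 v + cnt t 2 v := by
    intro v
    rw [h.card_flags_mul]
    have f1 : ¬ dist (T.points 0) (T.points 1) = dist (T.points 1) (T.points 2) := by
      intro h'; linarith
    have f2 : ¬ dist (T.points 1) (T.points 0) = dist (T.points 1) (T.points 2) := by
      intro h'; linarith
    have f3 : ¬ dist (T.points 2) (T.points 0) = dist (T.points 1) (T.points 2) := by
      intro h'; linarith
    have f4 : ¬ dist (T.points 0) (T.points 2) = dist (T.points 1) (T.points 2) := by
      intro h'; linarith
    simp [Fin.sum_univ_three, f1, f2, f3, f4, e21]
  have grp : ∀ (v : Plane), (cnt t 0 v : ℝ) * ang T 0 + cnt t 1 v * ang T 1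
      + cnt t 2 v * ang T 2 = cnt t 0 v * ang T 0 + (cnt t 1 v + cnt t 2 v : ℕ) * ang T 1 := by
    intro v; rw [← h12]; push_cast; ring
  have n0 : ∀ v, (0:ℝ) ≤ cnt t 0 v * ang T 0 := fun v => by positivity
  have eq := h.cnt_eq_of_le {1, 2} (by
      intro v hv hvt
      have hd := h.dens_inside hv hvt
      rw [grp] at hd
      rw [Finset.sum_pair (by decide), Finset.card_pair (by decide)]
      have he := h.even_flags hv (ρ * dist (T.points 1) (T.points 2))
      rw [flag] at he
      have : cnt t 1 v + cnt t 2 v < 6 := by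
        apply lt_of_mul_lt hB (X := 2 * Real.pi) (by linarith [n0 v])
        push_cast; linarith
      obtain ⟨m, hm⟩ := he
      omega) (by
      intro v c hv hvt
      have hd := h.dens_onSide hv hvt
      rw [grp] at hd
      rw [Finset.sum_pair (by decide), Finset.card_pair (by decide)]
      have : cnt t 1 v + cnt t 2 v < 3 := by
        apply lt_of_mul_lt hB (X := Real.pi) (by linarith [n0 v])
        push_cast; linarith
      omega) (by
      intro a
      have hd := h.dens_at_corner a
      rw [grp] at hd
      rw [Finset.sum_pair (by decide)]
      split_ifs with ha
      · have haB : ang T a = ang T 1 := by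
          simp only [Finset.mem_insert, Finset.mem_singleton] at ha
          rcases ha with rfl | rfl
          · rfl
          · exact h12.symm
        have : cnt t 1 (T.points a) + cnt t 2 (T.points a) < 2 := by
          apply lt_of_mul_lt hB (X := ang T a) (by linarith [n0 (T.points a)])
          push_cast; linarith
        omega
      · have haA : a = 0 := by
          revert ha; clear * -; revert a; decide
        have : cnt t 1 (T.points a) + cnt t 2 (T.points a) < 1 := by
          apply lt_of_mul_lt hB (X := ang T a) (by linarith [n0 (T.points a)])
          rw [haA]; push_cast; linarith
        omega)
  have side : ∀ {v : Plane} {c : Fin 3}, OnSide T c v → (∃ i k, (t i).points k = v) →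
      cnt t 1 v + cnt t 2 v = 2 ∧ cnt t 0 v = 1 := by
    intro v c hv hvt
    have h2 := eq.1 v c hv hvt
    rw [Finset.sum_pair (by decide), Finset.card_pair (by decide)] at h2
    refine ⟨h2, ?_⟩
    have hd := h.dens_onSide hv hvt
    rw [grp, h2] at hd
    have : (cnt t 0 v : ℝ) * ang T 0 = 1 * ang T 0 := by push_cast at hd; linarith
    exact_mod_cast mul_right_cancel₀ hA.ne' this
  have corner1 : cnt t 1 (T.points 1) + cnt t 2 (T.points 1) = 1 ∧ cnt t 0 (T.points 1) = 0 := by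
    have h2 := eq.2 1
    rw [Finset.sum_pair (by decide), if_pos (by decide)] at h2
    refine ⟨h2, ?_⟩
    have hd := h.dens_at_corner 1
    rw [grp, h2] at hd
    have : (cnt t 0 (T.points 1) : ℝ) * ang T 0 = 0 * ang T 0 := by push_cast at hd; linarith
    exact_mod_cast mul_right_cancel₀ hA.ne' this
  have pat : ∀ a b : Fin 3, a ≠ 0 → b ≠ 0 → a ≠ b →
      dist (T.points a) (T.points b) = dist (T.points 1) (T.points 2) := by
    intro a b ha hb hab
    fin_cases a <;> fin_cases b <;> simp at ha hb hab ⊢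
    exact e21
  have pat' : ∀ a : Fin 3, a ≠ 0 → dist (T.points a) (T.points 0) = dist (T.points 1) (T.points 0) := by
    intro a ha
    fin_cases a <;> simp at ha ⊢
    exact d2
  have third : ∀ {a b c : Fin 3}, a ≠ b → a ≠ c → b ≠ c → a ≠ 0 → b ≠ 0 → c = 0 := by
    intro a b c hab hac hbc ha hb
    rcases fin3_cases hab hac hbc 0 with h' | h' | h'
    · exact absurd h'.symm ha
    · exact absurd h'.symm hb
    · exact h'.symm
  apply h.hasRow (Pat := fun a b => a ≠ 0 ∧ b ≠ 0) (a := 1)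
  · refine ⟨?_, ?_, ?_, ?_⟩
    · rintro a b c a' b' c' h1 h2 h3 h1' h2' h3' ⟨ha, hb⟩ ⟨ha', hb'⟩
      obtain rfl := third h1 h2 h3 ha hb
      obtain rfl := third h1' h2' h3' ha' hb'
      refine ⟨?_, ?_, ?_⟩
      · rw [pat _ _ ha hb h1, pat _ _ ha' hb' h1']
      · rw [pat' _ ha, pat' _ ha']
      · rw [pat' _ hb, pat' _ hb']
    · rintro v c hv i a b _ _ hib
      obtain ⟨s1, s2⟩ := side hv ⟨i, b, hib⟩
      rw [Fin.sum_univ_three]; omega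
    · rintro v c hv i a b hab ⟨ha, hb⟩ hib
      obtain ⟨s1, s2⟩ := side hv ⟨i, b, hib⟩
      rw [pat _ _ ha hb hab, flag, s1]
      exact even_two
    · rintro v c hv i a b hab ⟨ha, hb⟩ hib j a' b' hji hab' hja hd
      rw [pat _ _ ha hb hab] at hd
      constructor
      · rintro rfl
        rw [dist_comm, pat' _ hab'.symm] at hd; linarith
      · rintro rfl
        rw [pat' _ hab'] at hd; linarith
  · rw [Fin.sum_univ_three]; omega
  · intro i k hik
    have hk : k ≠ 0 := by
      rintro rfl
      have := one_le_cnt hik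
      omega
    have : ∃ l : Fin 3, k ≠ l ∧ k ≠ 0 ∧ l ≠ 0 := by
      revert hk; clear * -; revert k; decide
    exact this
  · rintro b c h1 h2 h3 a' b' c' h1' h2' h3' ⟨ha', hb'⟩ hle
    obtain rfl := third h1' h2' h3' ha' hb'
    have hb : b ≠ 0 := by
      rintro rfl
      have : ang T b' = ang T 1 := by
        fin_cases b' <;> simp at hb' ⊢
        exact h12.symm
      linarith
    obtain rfl := third h1 h2 h3 (by decide) hb
    exact ⟨by rw [pat _ _ ha' hb' h1', pat _ _ (by decide) hb h1], pat' _ ha'⟩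

/-- The pattern is the shortest side, traversed from the largest angle to the middle one. The global
count gives exactly one largest angle at every vertex on a side; if a middle angle is there too, the
three angles occur once each. -/
lemma hasRow_scalene (h : EdgeTiling T t ρ) (h01 : ang T 0 < ang T 1) (h12 : ang T 1 < ang T 2)
    (hob : ang T 2 ≠ Real.pi / 2) : HasRow T t ρ := by
  have hs := sum_three_ang T
  have hA := ang_pos T 0
  have hB := ang_pos T 1
  have hC := ang_pos T 2
  have d1 : dist (T.points 1) (T.points 2) < dist (T.points 0) (T.points 2) :=
    (ang_lt_iff T (by decide) (by decide) (by decide)).1 h01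
  have d2 : dist (T.points 2) (T.points 0) < dist (T.points 1) (T.points 0) :=
    (ang_lt_iff T (by decide) (by decide) (by decide)).1 h12
  have e20 := dist_comm (T.points 2) (T.points 0)
  have e10 := dist_comm (T.points 1) (T.points 0)
  have e21 := dist_comm (T.points 2) (T.points 1)
  have g1 : dist (T.points 0) (T.points 1) ≠ dist (T.points 1) (T.points 2) := by
    intro h'; linarith
  have g2 : dist (T.points 0) (T.points 2) ≠ dist (T.points 1) (T.points 2) := by
    intro h'; linarith
  have g3 : dist (T.points 0) (T.points 1) ≠ dist (T.points 0) (T.points 2) := by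
    intro h'; linarith
  have flag : ∀ v, (flags t v (ρ * dist (T.points 1) (T.points 2))).card
      = cnt t 1 v + cnt t 2 v := by
    intro v
    rw [h.card_flags_mul]
    simp [Fin.sum_univ_three, e10, e20, e21, g1, g2]
  have flag' : ∀ v, (flags t v (ρ * dist (T.points 0) (T.points 2))).card
      = cnt t 0 v + cnt t 2 v := by
    intro v
    rw [h.card_flags_mul]
    simp [Fin.sum_univ_three, e10, e20, e21, g2.symm, g3]
  have n0 : ∀ v, (0:ℝ) ≤ cnt t 0 v * ang T 0 := fun v => by positivity
  have n1 : ∀ v, (0:ℝ) ≤ cnt t 1 v * ang T 1 := fun v => by positivity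
  have n2 : ∀ v, (0:ℝ) ≤ cnt t 2 v * ang T 2 := fun v => by positivity
  have eq := h.cnt_eq_of_le {2} (by
      intro v hv hvt
      have hd := h.dens_inside hv hvt
      rw [Finset.sum_singleton, Finset.card_singleton]
      have he := h.even_flags hv (ρ * dist (T.points 1) (T.points 2))
      have he' := h.even_flags hv (ρ * dist (T.points 0) (T.points 2))
      rw [flag] at he
      rw [flag'] at he'
      -- The flags of the two shorter lengths make all three counts congruent modulo `2`. If they
      -- are even, halving them gives angle sum `π`; if odd, removing one angle of each kind does.
      -- In both cases `le_one_of_largest` applies.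
      rcases Nat.even_or_odd' (cnt t 2 v) with ⟨s, hs2 | hs2⟩
      · obtain ⟨p, hp⟩ : ∃ p, cnt t 0 v = 2 * p := by
          obtain ⟨m, hm⟩ := he'; exact ⟨m - s, by omega⟩
        obtain ⟨q, hq⟩ : ∃ q, cnt t 1 v = 2 * q := by
          obtain ⟨m, hm⟩ := he; exact ⟨m - s, by omega⟩
        have := le_one_of_largest (p := p) (q := q) (s := s) hA h01.le h12 hob hs (by
          rw [hp, hq, hs2] at hd; push_cast at hd; linarith)
        omega
      · obtain ⟨p, hp⟩ : ∃ p, cnt t 0 v = p + 1 := by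
          obtain ⟨m, hm⟩ := he'; exact ⟨cnt t 0 v - 1, by omega⟩
        obtain ⟨q, hq⟩ : ∃ q, cnt t 1 v = q + 1 := by
          obtain ⟨m, hm⟩ := he; exact ⟨cnt t 1 v - 1, by omega⟩
        have := le_one_of_largest (p := p) (q := q) (s := 2 * s) hA h01.le h12 hob hs (by
          rw [hp, hq, hs2] at hd; push_cast at hd ⊢; linarith)
        omega) (by
      intro v c hv hvt
      rw [Finset.sum_singleton, Finset.card_singleton]
      exact le_one_of_largest hA h01.le h12 hob hs (h.dens_onSide hv hvt)) (by
      intro a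
      have hd := h.dens_at_corner a
      rw [Finset.sum_singleton]
      split_ifs with ha
      · rw [Finset.mem_singleton] at ha
        have : cnt t 2 (T.points a) < 2 := by
          apply lt_of_mul_lt hC (X := ang T a) (by linarith [n0 (T.points a), n1 (T.points a)])
          rw [ha]; push_cast; linarith
        omega
      · have haA : ang T a < ang T 2 := by
          fin_cases a <;> simp at ha ⊢ <;> linarith
        have : cnt t 2 (T.points a) < 1 := by
          apply lt_of_mul_lt hC (X := ang T a) (by linarith [n0 (T.points a), n1 (T.points a)])
          push_cast; linarith
        omega)
  have side : ∀ {v : Plane} {c : Fin 3}, OnSide T c v → ∀ {i}, (t i).points 1 = v →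
      cnt t 0 v = 1 ∧ cnt t 1 v = 1 ∧ cnt t 2 v = 1 := by
    intro v c hv i hi
    have h2 := eq.1 v c hv ⟨i, 1, hi⟩
    rw [Finset.sum_singleton, Finset.card_singleton] at h2
    have hd := h.dens_onSide hv ⟨i, 1, hi⟩
    have h1 := one_le_cnt hi
    rw [h2] at hd
    push_cast at hd
    have h1' : cnt t 1 v < 2 := by
      apply lt_of_mul_lt hB (X := ang T 0 + ang T 1) (by linarith [n0 v])
      push_cast; linarith
    have h3 : cnt t 1 v = 1 := by omega
    rw [h3] at hd
    have : (cnt t 0 v : ℝ) * ang T 0 = 1 * ang T 0 := by push_cast at hd; linarith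
    exact ⟨by exact_mod_cast mul_right_cancel₀ hA.ne' this, h3, h2⟩
  have corner2 : cnt t 0 (T.points 2) = 0 ∧ cnt t 1 (T.points 2) = 0 ∧ cnt t 2 (T.points 2) = 1 := by
    have h2 := eq.2 2
    rw [Finset.sum_singleton, if_pos (by decide)] at h2
    have hd := h.dens_at_corner 2
    rw [h2] at hd
    push_cast at hd
    refine ⟨?_, ?_, h2⟩
    · have : (cnt t 0 (T.points 2) : ℝ) * ang T 0 = 0 * ang T 0 := by
        linarith [n0 (T.points 2), n1 (T.points 2)]
      exact_mod_cast mul_right_cancel₀ hA.ne' this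
    · have : (cnt t 1 (T.points 2) : ℝ) * ang T 1 = 0 * ang T 1 := by
        linarith [n0 (T.points 2), n1 (T.points 2)]
      exact_mod_cast mul_right_cancel₀ hB.ne' this
  have third' : ∀ c : Fin 3, 2 ≠ c → 1 ≠ c → c = 0 := by decide
  have third {c : Fin 3} := third' c
  apply h.hasRow (Pat := fun a b => a = 2 ∧ b = 1) (a := 2)
  · refine ⟨?_, ?_, ?_, ?_⟩
    · rintro a b c a' b' c' h1 h2 h3 h1' h2' h3' ⟨rfl, rfl⟩ ⟨rfl, rfl⟩
      obtain rfl := third h2 h3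
      obtain rfl := third h2' h3'
      exact ⟨rfl, rfl, rfl⟩
    · rintro v c hv i a b _ ⟨rfl, rfl⟩ hib
      obtain ⟨s1, s2, s3⟩ := side hv hib
      rw [Fin.sum_univ_three]; omega
    · rintro v c hv i a b hab ⟨rfl, rfl⟩ hib
      obtain ⟨s1, s2, s3⟩ := side hv hib
      rw [e21, flag, s2, s3]
      exact even_two
    · rintro v c hv i a b hab ⟨rfl, rfl⟩ hib j a' b' hji hab' hja hd
      -- The only corner with label `1` at `v` belongs to tile `i`; an edge of shortest length in
      -- another tile therefore starts at label `2`.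
      have ha1 : a' ≠ 1 := by
        rintro rfl
        have := two_le_cnt hji hib hja
        have := (side hv hib).2.1
        omega
      rw [e21] at hd
      clear * - hd ha1 hab' g1 g2 e10 e20
      fin_cases a' <;> fin_cases b' <;> simp [e10, e20, g1, g2] at hd ha1 hab' ⊢
  · rw [Fin.sum_univ_three]; omega
  · intro i k hik
    refine ⟨1, ?_, ?_, rfl⟩
    · rintro rfl
      have := one_le_cnt hik
      omega
    · by_contra hk
      have := one_le_cnt hik
      have : k = 0 ∨ k = 1 := by
        revert hk; clear * -; revert k; decide
      rcases this with rfl | rfl <;> omega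
  · rintro b c h1 h2 h3 a' b' c' h1' h2' h3' ⟨rfl, rfl⟩ hle
    obtain rfl := third h2' h3'
    have hb : b = 1 := by
      by_contra hb
      have : b = 0 := third h1 (Ne.symm hb)
      subst this; linarith
    subst hb
    obtain rfl := third h2 h3
    exact ⟨rfl, rfl⟩

/-- An edge-to-edge tiling of an oblique triangle contains a row of cells of a trivial tiling. -/
lemma exists_row (h : EdgeTiling T t ρ) (h01 : ang T 0 ≤ ang T 1) (h12 : ang T 1 ≤ ang T 2)
    (hob : ang T 2 ≠ Real.pi / 2) : HasRow T t ρ := by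
  rcases h01.lt_or_eq with h01 | h01 <;> rcases h12.lt_or_eq with h12 | h12
  · exact h.hasRow_scalene h01 h12 hob
  · exact h.hasRow_large_base h01 h12
  · exact h.hasRow_small_base h01 h12 hob
  · exact h.hasRow_equilateral h01 h12

end EdgeTiling

/-! ### Cells of the trivial tiling in barycentric coordinates. -/

lemma range_fin3 {α : Type*} {a b c : Fin 3} (hab : a ≠ b) (hac : a ≠ c) (hbc : b ≠ c)
    (f : Fin 3 → α) : range f = {f a, f b, f c} := by
  ext x
  simp only [mem_range, mem_insert_iff, mem_singleton_iff]
  constructor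
  · rintro ⟨k, rfl⟩
    rcases fin3_cases hab hac hbc k with rfl | rfl | rfl <;> simp
  · rintro (rfl | rfl | rfl) <;> exact ⟨_, rfl⟩

/-- The point with barycentric coordinates `x k / n`. -/
noncomputable def latticePoint (p : Fin 3 → Plane) (n : ℕ) (x : Fin 3 → ℕ) : Plane :=
  ∑ k, ((x k : ℝ) / n) • p k

/-- A cell of the trivial tiling that is a translate of a scaled copy of the whole triangle. -/
noncomputable def upCell (p : Fin 3 → Plane) (n : ℕ) (y : Fin 3 → ℕ) : Set Plane :=
  convexHull ℝ (range fun k => latticePoint p n fun l => y l + if l = k then 1 else 0)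

/-- A cell of the trivial tiling that is rotated by a half turn. -/
noncomputable def downCell (p : Fin 3 → Plane) (n : ℕ) (y : Fin 3 → ℕ) : Set Plane :=
  convexHull ℝ (range fun k => latticePoint p n fun l => y l + if l = k then 0 else 1)

/-- The cells of the trivial tiling, described symmetrically in the three corners. -/
def symCells (p : Fin 3 → Plane) (n : ℕ) : Set (Set Plane) :=
  {S | ∃ y : Fin 3 → ℕ, ∑ k, y k + 1 = n ∧ S = upCell p n y} ∪
  {S | ∃ y : Fin 3 → ℕ, ∑ k, y k + 2 = n ∧ S = downCell p n y}

/-- The cells of the trivial tiling along the side opposite to the corner `c`. -/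
def rowCells (p : Fin 3 → Plane) (n : ℕ) (c : Fin 3) : Set (Set Plane) :=
  {S | ∃ y : Fin 3 → ℕ, y c = 0 ∧ ∑ k, y k + 1 = n ∧ S = upCell p n y} ∪
  {S | ∃ y : Fin 3 → ℕ, y c = 0 ∧ ∑ k, y k + 2 = n ∧ S = downCell p n y}

lemma gridPoint_eq (T : Tri) {n : ℕ} (hn : 1 ≤ n) (x : Fin 3 → ℕ) (hx : ∑ k, x k = n) :
    gridPoint T n (x 1) (x 2) = latticePoint T.points n x := by
  have hn' : (n : ℝ) ≠ 0 := by positivity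
  rw [Fin.sum_univ_three] at hx
  have h0 : (x 0 : ℝ) / n = 1 - x 1 / n - x 2 / n := by
    rw [← hx] at hn' ⊢; push_cast at hn' ⊢; field_simp; ring
  rw [gridPoint, latticePoint, Fin.sum_univ_three, h0]
  module

/-- The description by barycentric coordinates treats the three corners alike, so the corners may be
sorted by angle and the row may lie along any side. -/
lemma gridCells_eq_symCells (T : Tri) {n : ℕ} (hn : 1 ≤ n) :
    gridCells T n = symCells T.points n := by
  have up : ∀ y : Fin 3 → ℕ, ∑ k, y k + 1 = n → upCell T.points n y = convexHull ℝ
      {gridPoint T n (y 1) (y 2), gridPoint T n (y 1 + 1) (y 2), gridPoint T n (y 1) (y 2 + 1)} := by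
    intro y hy
    have e : ∀ k : Fin 3, ∑ l, (y l + if l = k then 1 else 0) = n := by
      intro k; rw [Finset.sum_add_distrib]; simpa using hy
    rw [upCell, range_fin3 (a := 0) (b := 1) (c := 2) (by decide) (by decide) (by decide),
      ← gridPoint_eq T hn _ (e 0), ← gridPoint_eq T hn _ (e 1), ← gridPoint_eq T hn _ (e 2)]
    simp
  have down : ∀ y : Fin 3 → ℕ, ∑ k, y k + 2 = n → downCell T.points n y = convexHull ℝ
      {gridPoint T n (y 1 + 1) (y 2 + 1), gridPoint T n (y 1 + 1) (y 2),
        gridPoint T n (y 1) (y 2 + 1)} := by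
    intro y hy
    have e : ∀ k : Fin 3, ∑ l, (y l + if l = k then 0 else 1) = n := by
      intro k; rw [Finset.sum_add_distrib, ← hy]; congr 1
      revert k; decide
    rw [downCell, range_fin3 (a := 0) (b := 2) (c := 1) (by decide) (by decide) (by decide),
      ← gridPoint_eq T hn _ (e 0), ← gridPoint_eq T hn _ (e 1), ← gridPoint_eq T hn _ (e 2)]
    simp
  have lift : ∀ i j m : ℕ, i + j + m ≤ n → ∃ y : Fin 3 → ℕ, ∑ k, y k + m = n ∧ y 1 = i ∧ y 2 = j := by
    intro i j m h
    refine ⟨![n - m - i - j, i, j], ?_, rfl, rfl⟩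
    rw [Fin.sum_univ_three]
    change n - m - i - j + i + j + m = n
    omega
  ext S
  constructor
  · rintro (⟨i, j, h, rfl⟩ | ⟨i, j, h, rfl⟩)
    · obtain ⟨y, hy, rfl, rfl⟩ := lift i j 1 h
      exact Or.inl ⟨y, hy, (up y hy).symm⟩
    · obtain ⟨y, hy, rfl, rfl⟩ := lift i j 2 h
      exact Or.inr ⟨y, hy, (down y hy).symm⟩
  · rintro (⟨y, hy, rfl⟩ | ⟨y, hy, rfl⟩)
    · rw [Fin.sum_univ_three] at hy
      exact Or.inl ⟨y 1, y 2, by omega, up y (by rw [Fin.sum_univ_three]; exact hy)⟩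
    · rw [Fin.sum_univ_three] at hy
      exact Or.inr ⟨y 1, y 2, by omega, down y (by rw [Fin.sum_univ_three]; exact hy)⟩

lemma latticePoint_comp (p : Fin 3 → Plane) (n : ℕ) (σ : Equiv.Perm (Fin 3)) (x : Fin 3 → ℕ) :
    latticePoint (p ∘ σ) n (x ∘ σ) = latticePoint p n x := by
  rw [latticePoint, latticePoint]
  exact Equiv.sum_comp σ fun k => ((x k : ℝ) / n) • p k

lemma upCell_comp (p : Fin 3 → Plane) (n : ℕ) (σ : Equiv.Perm (Fin 3)) (y : Fin 3 → ℕ) :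
    upCell (p ∘ σ) n (y ∘ σ) = upCell p n y := by
  have : (fun k => latticePoint (p ∘ σ) n fun l => (y ∘ σ) l + if l = k then 1 else 0)
      = (fun k => latticePoint p n fun l => y l + if l = k then 1 else 0) ∘ σ := by
    funext k
    simp only [Function.comp_apply]
    rw [← latticePoint_comp p n σ]
    congr 1
    funext l
    simp [σ.injective.eq_iff]
  rw [upCell, this, σ.surjective.range_comp]
  rfl

lemma downCell_comp (p : Fin 3 → Plane) (n : ℕ) (σ : Equiv.Perm (Fin 3)) (y : Fin 3 → ℕ) :
    downCell (p ∘ σ) n (y ∘ σ) = downCell p n y := by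
  have : (fun k => latticePoint (p ∘ σ) n fun l => (y ∘ σ) l + if l = k then 0 else 1)
      = (fun k => latticePoint p n fun l => y l + if l = k then 0 else 1) ∘ σ := by
    funext k
    simp only [Function.comp_apply]
    rw [← latticePoint_comp p n σ]
    congr 1
    funext l
    simp [σ.injective.eq_iff]
  rw [downCell, this, σ.surjective.range_comp]
  rfl

lemma symCells_comp (p : Fin 3 → Plane) (n : ℕ) (σ : Equiv.Perm (Fin 3)) :
    symCells (p ∘ σ) n = symCells p n := by
  have key : ∀ (p : Fin 3 → Plane) (σ : Equiv.Perm (Fin 3)), symCells p n ⊆ symCells (p ∘ σ) n := by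
    rintro p σ S (⟨y, hy, rfl⟩ | ⟨y, hy, rfl⟩)
    · exact Or.inl ⟨y ∘ σ, by rw [← hy]; congr 1; exact Equiv.sum_comp σ y, (upCell_comp p n σ y).symm⟩
    · exact Or.inr ⟨y ∘ σ, by rw [← hy]; congr 1; exact Equiv.sum_comp σ y, (downCell_comp p n σ y).symm⟩
  refine Subset.antisymm ?_ (key p σ)
  have := key (p ∘ σ) σ.symm
  rwa [Function.comp_assoc, Equiv.self_comp_symm, Function.comp_id] at this

lemma bc_sum (T : Tri) (j : Fin 3) (w : Fin 3 → ℝ) (hw : ∑ k, w k = 1) (f : Fin 3 → Plane) :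
    bc T j (∑ k, w k • f k) = ∑ k, w k * bc T j (f k) := by
  have e : ∀ x, bc T j x = bc T j 0 + (bc T j).linear x := by
    intro x; rw [← bc_add, zero_add]
  rw [e, map_sum]
  simp_rw [e (f _), map_smul, smul_eq_mul, mul_add]
  rw [Finset.sum_add_distrib, ← Finset.sum_mul, hw, one_mul]

lemma mem_convexHull_range {f : Fin 3 → Plane} {z : Plane} (T : Tri) (w : Fin 3 → ℝ)
    (h0 : ∀ k, 0 ≤ w k) (h1 : ∑ k, w k = 1) (hz : ∀ j, bc T j z = ∑ k, w k * bc T j (f k)) :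
    z ∈ convexHull ℝ (range f) := by
  have : z = ∑ k, w k • f k := bc_ext T fun j => by rw [hz, bc_sum T j w h1]
  rw [this]
  exact (convex_convexHull ℝ _).sum_mem (fun k _ => h0 k) h1
    fun k _ => subset_convexHull ℝ _ (mem_range_self k)

lemma bc_latticePoint (T : Tri) {n : ℕ} (hn : 1 ≤ n) {x : Fin 3 → ℕ} (hx : ∑ k, x k = n)
    (j : Fin 3) : bc T j (latticePoint T.points n x) = x j / n := by
  have hn' : (n : ℝ) ≠ 0 := by positivity
  rw [latticePoint, bc_sum]
  · simp_rw [bc_points]; simp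
  · rw [← Finset.sum_div, ← Nat.cast_sum, hx, div_self hn']

lemma sum_add_up (y : Fin 3 → ℕ) (k : Fin 3) :
    ∑ l, (y l + if l = k then 1 else 0) = ∑ l, y l + 1 := by
  rw [Finset.sum_add_distrib]; simp

lemma sum_add_down (y : Fin 3 → ℕ) (k : Fin 3) :
    ∑ l, (y l + if l = k then 0 else 1) = ∑ l, y l + 2 := by
  rw [Finset.sum_add_distrib]; congr 1; revert k; decide

/-- The weights of `z` relative to the corners of the cell are `n * bc T k z - y k`. -/
lemma mem_upCell (T : Tri) {n : ℕ} (hn : 1 ≤ n) {y : Fin 3 → ℕ} (hy : ∑ k, y k + 1 = n) {z : Plane}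
    (hz : ∀ k, (y k : ℝ) ≤ n * bc T k z) : z ∈ upCell T.points n y := by
  have hn' : (n : ℝ) ≠ 0 := by positivity
  have hs : ∑ k, (n * bc T k z - y k) = 1 := by
    rw [Finset.sum_sub_distrib, ← Finset.mul_sum, sum_bc, ← hy]; push_cast; ring
  refine mem_convexHull_range T (fun k => n * bc T k z - y k) (fun k => by linarith [hz k]) hs ?_
  intro j
  simp_rw [bc_latticePoint T hn ((sum_add_up y _).trans hy)]
  push_cast
  simp_rw [← mul_div_assoc, ← Finset.sum_div, mul_add, Finset.sum_add_distrib, ← Finset.sum_mul, hs]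
  simp
  field_simp

/-- Here the weights are `y k + 1 - n * bc T k z`, because corner `k` is the one whose coordinate
`k` is not raised. -/
lemma mem_downCell (T : Tri) {n : ℕ} (hn : 1 ≤ n) {y : Fin 3 → ℕ} (hy : ∑ k, y k + 2 = n)
    {z : Plane} (hz : ∀ k, n * bc T k z ≤ (y k : ℝ) + 1) : z ∈ downCell T.points n y := by
  have hn' : (n : ℝ) ≠ 0 := by positivity
  have hs : ∑ k, (y k + 1 - n * bc T k z) = 1 := by
    rw [Finset.sum_sub_distrib, ← Finset.mul_sum, sum_bc, ← hy, Finset.sum_add_distrib]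
    push_cast; simp; ring
  refine mem_convexHull_range T (fun k => y k + 1 - n * bc T k z) (fun k => by linarith [hz k]) hs ?_
  intro j
  simp_rw [bc_latticePoint T hn ((sum_add_down y _).trans hy)]
  have e : ∀ k, (((y j + if j = k then 0 else 1 : ℕ)) : ℝ) = (y j + 1) - if j = k then 1 else 0 := by
    intro k; split_ifs <;> push_cast <;> ring
  simp_rw [e, ← mul_div_assoc, ← Finset.sum_div, mul_sub, Finset.sum_sub_distrib, ← Finset.sum_mul, hs]
  simp
  field_simp

/-- The cells along a side cover a neighbourhood of this side. -/
lemma exists_rowCell (T : Tri) {n : ℕ} (hn : 1 ≤ n) {c : Fin 3} {z : Plane}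
    (hz : z ∈ T.closedInterior) (hc : bc T c z < 1 / n) : ∃ S ∈ rowCells T.points n c, z ∈ S := by
  have hn' : (0 : ℝ) < n := by positivity
  rw [mem_closedInterior] at hz
  set x : Fin 3 → ℝ := fun k => n * bc T k z with hx
  have hx0 : ∀ k, 0 ≤ x k := fun k => mul_nonneg hn'.le (hz k)
  have hxs : ∑ k, x k = n := by rw [hx, ← Finset.mul_sum, sum_bc, mul_one]
  set y : Fin 3 → ℕ := fun k => ⌊x k⌋₊ with hy
  have hyx : ∀ k, (y k : ℝ) ≤ x k := fun k => Nat.floor_le (hx0 k)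
  have hxy : ∀ k, x k < y k + 1 := fun k => Nat.lt_floor_add_one _
  have hyc : y c = 0 := by
    rw [hy]; simp only; rw [Nat.floor_eq_zero]
    rw [lt_div_iff₀ hn'] at hc
    rw [hx]; simp only; linarith
  have hle : ∑ k, y k ≤ n := by
    have : ((∑ k, y k : ℕ) : ℝ) ≤ n := by
      rw [← hxs]; push_cast; exact Finset.sum_le_sum fun k _ => hyx k
    exact_mod_cast this
  have hge : n < ∑ k, y k + 3 := by
    have : (n : ℝ) < ((∑ k, y k + 3 : ℕ) : ℝ) := by
      rw [← hxs, Fin.sum_univ_three, Fin.sum_univ_three]; push_cast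
      linarith [hxy 0, hxy 1, hxy 2]
    exact_mod_cast this
  -- The sum of the integer parts `y k` decides the kind of cell: `n - 1` gives an upright cell and
  -- `n - 2` a rotated one. If it is `n`, then `z` is a lattice point, and lowering a positive entry
  -- by one gives an upright cell with corner `z`.
  have hcases : ∑ k, y k = n ∨ ∑ k, y k + 1 = n ∨ ∑ k, y k + 2 = n := by omega
  rcases hcases with h | h | h
  · obtain ⟨k, hk⟩ : ∃ k, y k ≠ 0 := by
      by_contra hcon
      push Not at hcon
      rw [Finset.sum_eq_zero fun k _ => hcon k] at h
      omega
    have hs : ∑ l, (y l - if l = k then 1 else 0) + 1 = n := by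
      rw [Finset.sum_tsub_distrib _ fun l _ => by split_ifs with hl <;> [(subst hl; omega); omega], h]
      simp only [Finset.sum_ite_eq', Finset.mem_univ, if_true]
      omega
    refine ⟨_, Or.inl ⟨fun l => y l - if l = k then 1 else 0, ?_, hs, rfl⟩, mem_upCell T hn hs ?_⟩
    · simp [hyc]
    · intro l
      refine le_trans ?_ (hyx l)
      exact_mod_cast Nat.sub_le _ _
  · exact ⟨_, Or.inl ⟨y, hyc, h, rfl⟩, mem_upCell T hn h hyx⟩
  · exact ⟨_, Or.inr ⟨y, hyc, h, rfl⟩, mem_downCell T hn h fun k => (hxy k).le⟩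

lemma bc_le_of_mem_rowCell (T : Tri) {n : ℕ} (hn : 1 ≤ n) {c : Fin 3} {S : Set Plane}
    (hS : S ∈ rowCells T.points n c) {z : Plane} (hz : z ∈ S) : bc T c z ≤ 1 / n := by
  have hn' : (0 : ℝ) < n := by positivity
  have hconv : Convex ℝ {z | bc T c z ≤ 1 / n} := (convex_Iic (1 / (n:ℝ))).affine_preimage (bc T c)
  rcases hS with ⟨y, hyc, hy, rfl⟩ | ⟨y, hyc, hy, rfl⟩
  · refine convexHull_min ?_ hconv hz
    rintro _ ⟨k, rfl⟩
    change bc T c _ ≤ _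
    simp only
    rw [bc_latticePoint T hn ((sum_add_up y k).trans hy), hyc]
    apply div_le_div_of_nonneg_right _ hn'.le
    split_ifs <;> simp
  · refine convexHull_min ?_ hconv hz
    rintro _ ⟨k, rfl⟩
    change bc T c _ ≤ _
    simp only
    rw [bc_latticePoint T hn ((sum_add_down y k).trans hy), hyc]
    apply div_le_div_of_nonneg_right _ hn'.le
    split_ifs <;> simp

lemma Fits.exists_closedInterior {t : ι → Tri} {Pat : Fin 3 → Fin 3 → Prop} {x y z : Plane}
    (h : Fits t Pat x y z) : ∃ i, (t i).closedInterior = convexHull ℝ {x, y, z} := by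
  obtain ⟨i, a, b, c, hab, hac, hbc, _, rfl, rfl, rfl⟩ := h
  exact ⟨i, by rw [closedInterior_eq_convexHull, range_fin3 hab hac hbc]⟩

lemma HasRow.exists_rowCells {T : Tri} {t : ι → Tri} {ρ : ℝ} (h : HasRow T t ρ) :
    ∃ (c : Fin 3) (n : ℕ), 1 ≤ n ∧ (n : ℝ) * ρ = 1 ∧
      ∀ S ∈ rowCells T.points n c, ∃ i, (t i).closedInterior = S := by
  obtain ⟨a, b, c, hab, hac, hbc, n, hn, hnρ, hF, hG⟩ := h
  refine ⟨c, n, hn, hnρ, ?_⟩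
  have hn' : (n : ℝ) ≠ 0 := by positivity
  have hρ : ρ = 1 / n := by field_simp; linarith
  have pt : ∀ x : Fin 3 → ℕ, ∑ k, x k = n → latticePoint T.points n x
      = T.points a + (x b : ℝ) • ρ • (T.points b - T.points a)
        + (x c : ℝ) • ρ • (T.points c - T.points a) := by
    intro x hx
    rw [sum_fin3 hab hac hbc] at hx
    have hxa : (x a : ℝ) / n = 1 - x b * (1 / n) - x c * (1 / n) := by
      rw [← hx] at hn' ⊢; push_cast at hn' ⊢; field_simp; ring
    rw [latticePoint, sum_fin3 hab hac hbc, hxa, hρ, div_eq_mul_one_div (x b : ℝ),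
      div_eq_mul_one_div (x c : ℝ)]
    module
  rintro S (⟨y, hyc, hy, rfl⟩ | ⟨y, hyc, hy, rfl⟩)
  · obtain ⟨i, hi⟩ := (hF (y b) (by rw [sum_fin3 hab hac hbc] at hy; omega)).exists_closedInterior
    refine ⟨i, ?_⟩
    rw [hi, upCell, range_fin3 hab hac hbc, pt _ ((sum_add_up y a).trans hy),
      pt _ ((sum_add_up y b).trans hy), pt _ ((sum_add_up y c).trans hy)]
    simp [hbc, hab.symm, hac.symm, hbc.symm, hyc]
  · obtain ⟨i, hi⟩ := (hG (y b) (by rw [sum_fin3 hab hac hbc] at hy; omega)).exists_closedInterior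
    refine ⟨i, ?_⟩
    rw [hi, downCell, range_fin3 hac.symm hbc.symm hab, pt _ ((sum_add_down y a).trans hy),
      pt _ ((sum_add_down y b).trans hy), pt _ ((sum_add_down y c).trans hy)]
    simp [hbc, hab.symm, hac.symm, hbc.symm, hyc]
    congr 1
    rw [pair_comm]

/-! ### Removal of a row and induction on the number of tiles. -/

/-- The image of a triangle under the homothety with centre at the corner `c` and ratio `r`. -/
noncomputable def shrink (T : Tri) (c : Fin 3) {r : ℝ} (hr : 0 < r) : Tri :=
  T.map (AffineMap.homothety (T.points c) r) (by
    intro x y h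
    simpa [AffineMap.homothety_apply, hr.ne'] using h)

lemma shrink_points (T : Tri) (c : Fin 3) {r : ℝ} (hr : 0 < r) (k : Fin 3) :
    (shrink T c hr).points k = r • (T.points k - T.points c) + T.points c := by
  rfl

lemma dist_shrink (T : Tri) (c : Fin 3) {r : ℝ} (hr : 0 < r) (k l : Fin 3) :
    dist ((shrink T c hr).points k) ((shrink T c hr).points l)
      = r * dist (T.points k) (T.points l) := by
  rw [shrink_points, shrink_points, dist_add_right, dist_smul₀, Real.norm_of_nonneg hr.le,
    dist_sub_right]

lemma ang_shrink (T : Tri) (c : Fin 3) {r : ℝ} (hr : 0 < r) (k : Fin 3) :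
    ang (shrink T c hr) k = ang T k :=
  angle_eq_of_dist_eq_mul hr (dist_shrink ..) (dist_shrink ..) (dist_shrink ..)

lemma bc_shrink_points (T : Tri) (c : Fin 3) {r : ℝ} (hr : 0 < r) (j k : Fin 3) :
    bc T j ((shrink T c hr).points k)
      = (1 - r) * (if j = c then 1 else 0) + r * (if j = k then 1 else 0) := by
  rw [shrink_points, add_comm, bc_comb, bc_points, bc_points]

lemma bc_eq_bc_shrink (T : Tri) (c : Fin 3) {r : ℝ} (hr : 0 < r) (j : Fin 3) (x : Plane) :
    bc T j x = (1 - r) * (if j = c then 1 else 0) + r * bc (shrink T c hr) j x := by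
  conv_lhs => rw [← sum_bc_smul (shrink T c hr) x]
  rw [bc_sum T j _ (sum_bc _ x)]
  simp_rw [bc_shrink_points, mul_add, Finset.sum_add_distrib, ← Finset.sum_mul, sum_bc]
  simp
  ring

/-- The smaller triangle is what remains of `T` after cutting off a strip along the side opposite to
`c`. -/
lemma mem_shrink (T : Tri) (c : Fin 3) {r : ℝ} (hr : 0 < r) (hr1 : r ≤ 1) (x : Plane) :
    x ∈ (shrink T c hr).closedInterior ↔ x ∈ T.closedInterior ∧ 1 - r ≤ bc T c x := by
  rw [mem_closedInterior, mem_closedInterior]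
  have e := fun j => bc_eq_bc_shrink T c hr j x
  constructor
  · intro h
    refine ⟨fun k => ?_, ?_⟩
    · rw [e]
      have := mul_nonneg hr.le (h k)
      split_ifs <;> linarith
    · rw [e, if_pos rfl]
      have := mul_nonneg hr.le (h c)
      linarith
  · rintro ⟨h1, h2⟩ k
    refine nonneg_of_mul_nonneg_right ?_ hr
    by_cases hk : k = c
    · subst hk
      rw [e, if_pos rfl] at h2
      linarith
    · have := h1 k
      rw [e, if_neg hk] at this
      linarith

lemma one_sub_div_succ (N : ℕ) : 1 - (N : ℝ) / ((N + 1 : ℕ) : ℝ) = 1 / ((N + 1 : ℕ) : ℝ) := by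
  have : ((N + 1 : ℕ) : ℝ) ≠ 0 := by positivity
  field_simp; push_cast; ring

lemma latticePoint_shrink (T : Tri) (c : Fin 3) {N : ℕ} (hN : 1 ≤ N)
    (hr : (0 : ℝ) < N / ((N + 1 : ℕ) : ℝ)) {x : Fin 3 → ℕ} (hx : ∑ k, x k = N) :
    latticePoint (shrink T c hr).points N x
      = latticePoint T.points (N + 1) fun l => x l + if l = c then 1 else 0 := by
  have hN' : (N : ℝ) ≠ 0 := by positivity
  have hN1 : ((N + 1 : ℕ) : ℝ) ≠ 0 := by positivity
  apply bc_ext T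
  intro j
  rw [bc_eq_bc_shrink T c hr, bc_latticePoint _ hN hx, bc_latticePoint _ (by omega)
    ((sum_add_up x c).trans (by rw [hx])), one_sub_div_succ]
  split_ifs <;> field_simp <;> push_cast <;> ring

lemma upCell_shrink (T : Tri) (c : Fin 3) {N : ℕ} (hN : 1 ≤ N)
    (hr : (0 : ℝ) < N / ((N + 1 : ℕ) : ℝ)) {y : Fin 3 → ℕ} (hy : ∑ k, y k + 1 = N) :
    upCell (shrink T c hr).points N y
      = upCell T.points (N + 1) fun l => y l + if l = c then 1 else 0 := by
  rw [upCell, upCell]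
  congr 2
  funext k
  rw [latticePoint_shrink T c hN hr ((sum_add_up y k).trans hy)]
  congr 1; funext l; ring

lemma downCell_shrink (T : Tri) (c : Fin 3) {N : ℕ} (hN : 1 ≤ N)
    (hr : (0 : ℝ) < N / ((N + 1 : ℕ) : ℝ)) {y : Fin 3 → ℕ} (hy : ∑ k, y k + 2 = N) :
    downCell (shrink T c hr).points N y
      = downCell T.points (N + 1) fun l => y l + if l = c then 1 else 0 := by
  rw [downCell, downCell]
  congr 2
  funext k
  rw [latticePoint_shrink T c hN hr ((sum_add_down y k).trans hy)]
  congr 1; funext l; ring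

/-- Cells with `y c = 0` form the row; lowering a positive `y c` by one turns any other cell into a
cell of level `N` of the smaller triangle. -/
lemma symCells_succ (T : Tri) (c : Fin 3) {N : ℕ} (hN : 1 ≤ N)
    (hr : (0 : ℝ) < N / ((N + 1 : ℕ) : ℝ)) :
    symCells T.points (N + 1)
      = rowCells T.points (N + 1) c ∪ symCells (shrink T c hr).points N := by
  have lower : ∀ {y : Fin 3 → ℕ}, y c ≠ 0 → ∃ y' : Fin 3 → ℕ,
      y = (fun l => y' l + if l = c then 1 else 0) ∧ ∑ k, y' k + 1 = ∑ k, y k := by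
    intro y hy
    have e : y = (fun l => (y l - if l = c then 1 else 0) + if l = c then 1 else 0) := by
      funext l
      split_ifs with h
      · subst h; omega
      · rfl
    refine ⟨_, e, ?_⟩
    conv_rhs => rw [e]
    rw [sum_add_up]
  ext S
  constructor
  · rintro (⟨y, hy, rfl⟩ | ⟨y, hy, rfl⟩)
    · by_cases hc : y c = 0
      · exact Or.inl (Or.inl ⟨y, hc, hy, rfl⟩)
      · obtain ⟨y', rfl, hs⟩ := lower hc
        have hy' : ∑ k, y' k + 1 = N := by omega
        exact Or.inr (Or.inl ⟨y', hy', (upCell_shrink T c hN hr hy').symm⟩)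
    · by_cases hc : y c = 0
      · exact Or.inl (Or.inr ⟨y, hc, hy, rfl⟩)
      · obtain ⟨y', rfl, hs⟩ := lower hc
        have hy' : ∑ k, y' k + 2 = N := by omega
        exact Or.inr (Or.inr ⟨y', hy', (downCell_shrink T c hN hr hy').symm⟩)
  · rintro ((⟨y, _, hy, rfl⟩ | ⟨y, _, hy, rfl⟩) | (⟨y, hy, rfl⟩ | ⟨y, hy, rfl⟩))
    · exact Or.inl ⟨y, hy, rfl⟩
    · exact Or.inr ⟨y, hy, rfl⟩
    · exact Or.inl ⟨_, by rw [sum_add_up]; omega, upCell_shrink T c hN hr hy⟩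
    · exact Or.inr ⟨_, by rw [sum_add_up]; omega, downCell_shrink T c hN hr hy⟩

lemma upCell_one (T : Tri) : upCell T.points 1 (fun _ => 0) = T.closedInterior := by
  rw [closedInterior_eq_convexHull, upCell]
  congr 2
  funext k
  rw [latticePoint, Finset.sum_eq_single k]
  · simp
  · intro b _ hb; simp [hb]
  · simp

lemma eq_zero_of_sum_eq_zero {y : Fin 3 → ℕ} (hy : ∑ k, y k + 1 = 1) : y = fun _ => 0 := by
  funext k
  exact (Finset.sum_eq_zero_iff.1 (by omega : ∑ k, y k = 0)) k (Finset.mem_univ k)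

lemma symCells_one (T : Tri) : symCells T.points 1 = {T.closedInterior} := by
  ext S
  rw [mem_singleton_iff]
  constructor
  · rintro (⟨y, hy, rfl⟩ | ⟨y, hy, rfl⟩)
    · rw [eq_zero_of_sum_eq_zero hy, upCell_one]
    · omega
  · rintro rfl
    exact Or.inl ⟨fun _ => 0, by simp, (upCell_one T).symm⟩

namespace EdgeTiling

/-- Removing a row of cells leaves a tiling of a smaller triangle. -/
lemma peel {ι : Type*} [Fintype ι] {T : Tri} {t : ι → Tri} {ρ : ℝ} (h : EdgeTiling T t ρ)
    {c : Fin 3} {N : ℕ} (hN : 1 ≤ N) (hρ : ((N + 1 : ℕ) : ℝ) * ρ = 1)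
    (hr : (0 : ℝ) < N / ((N + 1 : ℕ) : ℝ))
    (hrow : ∀ S ∈ rowCells T.points (N + 1) c, ∃ i, (t i).closedInterior = S) :
    EdgeTiling (shrink T c hr)
      (fun i : {i // (t i).closedInterior ∉ rowCells T.points (N + 1) c} => t i) (1 / N) := by
  have hN' : (0 : ℝ) < N := by positivity
  have hN1 : (0 : ℝ) < ((N + 1 : ℕ) : ℝ) := by positivity
  have hr1 : (N : ℝ) / ((N + 1 : ℕ) : ℝ) ≤ 1 := by
    rw [div_le_one hN1]; push_cast; linarith
  have hmem := mem_shrink T c hr hr1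
  rw [one_sub_div_succ] at hmem
  refine ⟨?_, ?_, by positivity, ?_, ?_⟩
  · apply Subset.antisymm
    · apply iUnion_subset
      rintro ⟨i, hi⟩
      simp only
      rw [← closure_triInterior]
      refine closure_minimal ?_ (isClosed_triClosed _)
      intro x hx
      have hxT : x ∈ T.closedInterior := h.subset i (triInterior_subset _ hx)
      rw [hmem]
      refine ⟨hxT, ?_⟩
      -- An interior point of a tile in the strip lies in a row cell. That cell is itself a tile, so
      -- it is this tile, which was removed.
      by_contra hlt
      obtain ⟨S, hS, hxS⟩ := exists_rowCell T (by omega) hxT (not_le.1 hlt)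
      obtain ⟨j, rfl⟩ := hrow S hS
      have := eq_of_mem_interior h.disjoint hx hxS
      subst this
      exact hi hS
    · rw [← closure_triInterior (shrink T c hr)]
      refine closure_minimal ?_ (isClosed_iUnion_of_finite fun i => isClosed_triClosed _)
      intro x hx
      have hxT := ((hmem x).1 (triInterior_subset _ hx)).1
      rw [← h.covers, mem_iUnion] at hxT
      obtain ⟨i, hi⟩ := hxT
      rw [mem_iUnion]
      refine ⟨⟨i, fun hS => ?_⟩, hi⟩
      have h1 := bc_le_of_mem_rowCell T (by omega) hS hi
      have h2 := (mem_interior _ x).1 hx c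
      rw [bc_eq_bc_shrink T c hr, if_pos rfl, one_sub_div_succ] at h1
      have := mul_pos hr h2
      linarith
  · rintro ⟨i, _⟩ ⟨j, _⟩ hij
    exact h.disjoint i j fun h' => hij (Subtype.ext h')
  · rintro ⟨i, _⟩ k l
    simp only
    -- The old ratio is `1 / (N + 1)`, which is `1 / N` times the ratio `N / (N + 1)` of the smaller
    -- triangle.
    rw [h.dist_eq, dist_shrink, ← mul_assoc]
    congr 1
    field_simp
    linarith
  · rintro ⟨i, _⟩ ⟨j, _⟩ k hk
    exact h.edge i j k hk

/-- An edge-to-edge tiling of an oblique triangle is trivial. -/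
lemma range_eq_symCells (m : ℕ) : ∀ {ι : Type} [Fintype ι] {T : Tri} {t : ι → Tri} {ρ : ℝ},
    EdgeTiling T t ρ → ang T 0 ≤ ang T 1 → ang T 1 ≤ ang T 2 → ang T 2 ≠ Real.pi / 2 →
    Fintype.card ι = m → ∃ n : ℕ, 1 ≤ n ∧ (n : ℝ) * ρ = 1 ∧
      range (fun i => (t i).closedInterior) = symCells T.points n := by
  classical
  induction m using Nat.strong_induction_on with
  | _ m ih =>
    intro ι _ T t ρ h h01 h12 hob hm
    obtain ⟨c, n, hn, hρ, hrow⟩ := (h.exists_row h01 h12 hob).exists_rowCells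
    refine ⟨n, hn, hρ, ?_⟩
    obtain ⟨N, rfl⟩ := Nat.exists_eq_add_of_le' hn
    rcases Nat.eq_zero_or_pos N with rfl | hN
    -- For `N = 0` the row consists of the single cell `T`, so there is only one tile.
    · obtain ⟨i, hi⟩ := hrow _ (Or.inl ⟨fun _ => 0, rfl, by simp, rfl⟩)
      rw [upCell_one] at hi
      have huniq : ∀ j, j = i := by
        intro j
        obtain ⟨x, hx⟩ := nonempty_triInterior (t j)
        exact eq_of_mem_interior h.disjoint hx (hi ▸ h.subset j (triInterior_subset _ hx))
      rw [zero_add, symCells_one]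
      ext S
      rw [mem_singleton_iff, mem_range]
      constructor
      · rintro ⟨j, rfl⟩; rw [huniq j, hi]
      · rintro rfl; exact ⟨i, hi⟩
    · have hr : (0 : ℝ) < N / ((N + 1 : ℕ) : ℝ) := by positivity
      have hp := h.peel hN hρ hr hrow
      obtain ⟨n', _, hn', hrange⟩ := ih _ (by
          rw [← hm]
          have hne : ∃ S, S ∈ rowCells T.points (N + 1) c := by
            obtain ⟨a, _, hca, _⟩ := exists_others c
            refine ⟨_, Or.inl ⟨fun l => if l = a then N else 0, ?_, ?_, rfl⟩⟩
            · simp [hca]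
            · simp
          obtain ⟨S, hS⟩ := hne
          obtain ⟨i, rfl⟩ := hrow S hS
          exact Fintype.card_subtype_lt (x := i) (by simpa using hS)) hp
        (by rwa [ang_shrink, ang_shrink]) (by rwa [ang_shrink, ang_shrink])
        (by rwa [ang_shrink]) rfl
      -- The number of segments is the reciprocal of the scaling ratio, which is `1 / N` for the
      -- remaining tiles.
      have hnN : n' = N := by
        have : (N : ℝ) ≠ 0 := by positivity
        field_simp at hn'
        exact_mod_cast hn'
      subst hnN
      rw [symCells_succ T c hN hr, ← hrange]
      ext S
      rw [mem_union]
      constructor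
      · rintro ⟨i, rfl⟩
        by_cases hi : (t i).closedInterior ∈ rowCells T.points (n' + 1) c
        · exact Or.inl hi
        · exact Or.inr ⟨⟨i, hi⟩, rfl⟩
      · rintro (hS | ⟨⟨i, _⟩, rfl⟩)
        · obtain ⟨i, rfl⟩ := hrow S hS
          exact ⟨i, rfl⟩
        · exact ⟨i, rfl⟩

end EdgeTiling

/-! ### Reptilings without hanging vertices are edge-to-edge. -/

lemma onSideInterior_iff (S : Tri) (v : Plane) : OnSideInterior S v ↔ ∃ k, OnSide S k v := by
  constructor
  · rintro ⟨a, b, hab, h⟩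
    obtain ⟨c, hac, hbc⟩ := exists_third hab
    obtain ⟨⟨s, ⟨hs0, hs1⟩, rfl⟩, ha, hb⟩ := h
    rw [AffineMap.lineMap_apply, vsub_eq_sub, vadd_eq_add, add_comm] at ha hb ⊢
    have hs0' : 0 < s := lt_of_le_of_ne hs0 (by rintro rfl; simp at ha)
    have hs1' : s < 1 := lt_of_le_of_ne hs1 (by rintro rfl; simp at hb)
    refine ⟨c, ?_, fun l hl => ?_⟩
    · rw [bc_comb, bc_points_ne S hac.symm, bc_points_ne S hbc.symm]; ring
    · rw [bc_comb]
      rcases fin3_cases hab hac hbc l with rfl | rfl | rfl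
      · rw [bc_points_self, bc_points_ne S hab]; linarith
      · rw [bc_points_self, bc_points_ne S hab.symm]; linarith
      · exact absurd rfl hl
  · rintro ⟨c, hc, hpos⟩
    obtain ⟨a, b, hca, hcb, hab⟩ := exists_others c
    have hs := sum_bc S v
    rw [sum_fin3 hca hcb hab, hc, zero_add] at hs
    have ha := hpos a hca.symm
    have hb := hpos b hcb.symm
    have hv : v = AffineMap.lineMap (S.points a) (S.points b) (bc S b v) := by
      conv_lhs => rw [← sum_bc_smul S v]
      rw [sum_fin3 hca hcb hab, hc, AffineMap.lineMap_apply, vsub_eq_sub, vadd_eq_add,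
        show bc S a v = 1 - bc S b v by linarith]
      module
    refine ⟨a, b, hab, ?_⟩
    rw [hv, sbtw_lineMap_iff]
    exact ⟨points_ne S hab, hb, by linarith⟩

/-- The sum of the side lengths, each counted twice. -/
noncomputable def perim (p : Fin 3 → Plane) : ℝ := ∑ k, ∑ l, dist (p k) (p l)

lemma perim_comp (p : Fin 3 → Plane) (σ : Equiv.Perm (Fin 3)) : perim (p ∘ σ) = perim p := by
  rw [perim, perim]
  simp only [Function.comp_apply]
  rw [Equiv.sum_comp σ fun k => ∑ l, dist (p k) (p (σ l))]
  exact Finset.sum_congr rfl fun k _ => Equiv.sum_comp σ fun l => dist (p k) (p l)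

lemma perim_pos (T : Tri) : 0 < perim T.points := by
  rw [perim]
  refine Finset.sum_pos' (fun k _ => Finset.sum_nonneg fun l _ => dist_nonneg)
    ⟨0, Finset.mem_univ _, ?_⟩
  refine Finset.sum_pos' (fun l _ => dist_nonneg) ⟨1, Finset.mem_univ _, ?_⟩
  exact dist_pos.2 (points_ne T (by decide))

/-- The tiles of a reptiling are copies of `T` scaled by the same factor. -/
lemma exists_labelling {T : Tri} {r : ℕ} {t : Fin r → Tri} (ht : IsReptiling T t) :
    ∃ (ρ : ℝ) (σ : Fin r → Equiv.Perm (Fin 3)), 0 < ρ ∧ ∀ i k l,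
      dist ((t i).points (σ i k)) ((t i).points (σ i l)) = ρ * dist (T.points k) (T.points l) := by
  choose σ hσ using ht.similar
  have h1 := fun i => similar_iff_exists_pos_dist_eq.1 (hσ i)
  choose ρ hρ hd using h1
  -- The matchings of corners given by congruence need not be compatible with those given by
  -- similarity. The perimeter ignores labels and so shows that all ratios agree.
  have hper : ∀ i, perim (t i).points = ρ i * perim T.points := by
    intro i
    rw [← perim_comp _ (σ i), perim, perim, Finset.mul_sum]
    refine Finset.sum_congr rfl fun k _ => ?_
    rw [Finset.mul_sum]
    exact Finset.sum_congr rfl fun l _ => hd i k l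
  have hper' : ∀ i j, perim (t i).points = perim (t j).points := by
    intro i j
    obtain ⟨τ, hτ⟩ := ht.congruent i j
    rw [← perim_comp _ τ, perim, perim]
    exact Finset.sum_congr rfl fun k _ => Finset.sum_congr rfl fun l _ => hτ.dist_eq k l
  have hρeq : ∀ i j, (ρ i : ℝ) = ρ j := fun i j =>
    mul_right_cancel₀ (perim_pos T).ne' (by rw [← hper, ← hper, hper' i j])
  have hr : 0 < r := by have := ht.two_le; omega
  refine ⟨ρ ⟨0, hr⟩, σ, hρ _, fun i k l => ?_⟩
  rw [hρeq _ i]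
  exact hd i k l

/-- A reptiling without half vertices in the interior is edge-to-edge. -/
lemma corner_of_mem {T : Tri} {r : ℕ} {t : Fin r → Tri} (ht : IsReptiling T t)
    (hno : ¬ ∃ v ∈ T.interior, IsHalfVertex T t v) (i j : Fin r) (k : Fin 3)
    (hk : (t i).points k ∈ (t j).closedInterior) : ∃ l, (t i).points k = (t j).points l := by
  set v := (t i).points k with hv
  have hi : dens (t i) v = ang (t i) k := dens_corner _ _
  have hpos := ang_pos (t i) k
  have hlt := ang_lt_pi (t i) k
  have hsum := sum_dens ht.covers ht.disjoint v
  rcases position (t j) hk with h | ⟨c, h⟩ | ⟨l, h⟩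
  · have := eq_of_mem_interior ht.disjoint h (points_mem (t i) k)
    subst this
    exact ⟨k, rfl⟩
  -- Tile `j` contributes `π` at `v` and tile `i` a positive angle, too much for a boundary point of
  -- `T`. Inside `T` the absence of half vertices yields a second tile with `v` inside a side, and
  -- the total exceeds `2 * π`.
  · exfalso
    have hj := dens_side h
    have hij : i ≠ j := by
      rintro rfl; linarith
    have hge : ∀ s : Finset (Fin r), ∑ m ∈ s, dens (t m) v ≤ dens T v := fun s =>
      hsum ▸ Finset.sum_le_sum_of_subset_of_nonneg (Finset.subset_univ s)
        fun m _ _ => dens_nonneg _ _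
    have h2 := hge {i, j}
    rw [Finset.sum_pair hij, hi, hj] at h2
    have hvT : v ∈ T.closedInterior := by
      rw [← ht.covers]; exact mem_iUnion.2 ⟨i, points_mem (t i) k⟩
    rcases position T hvT with hT | ⟨d, hT⟩ | ⟨d, hT⟩
    · have hnot : ¬ ∃! m, OnSideInterior (t m) v := fun hu =>
        hno ⟨v, hT, ⟨i, k, hv⟩, Or.inr hu⟩
      have hjs : OnSideInterior (t j) v := (onSideInterior_iff _ _).2 ⟨c, h⟩
      obtain ⟨m, hm, hmj⟩ : ∃ m, OnSideInterior (t m) v ∧ m ≠ j := by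
        by_contra hcon
        push Not at hcon
        exact hnot ⟨j, hjs, hcon⟩
      obtain ⟨e, he⟩ := (onSideInterior_iff _ _).1 hm
      have hmd := dens_side he
      have him : i ≠ m := by
        rintro rfl; linarith
      have h3 := hge {i, j, m}
      rw [Finset.sum_insert (by simp [hij, him]), Finset.sum_pair hmj.symm, hi, hj, hmd,
        dens_interior T hT] at h3
      linarith
    · rw [dens_side hT] at h2; linarith
    · rw [hT, dens_corner] at h2
      linarith [ang_lt_pi T d]
  · exact ⟨l, h⟩

lemma ang_reindex (T : Tri) (τ : Equiv.Perm (Fin 3)) (k : Fin 3) :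
    ang (Affine.Simplex.reindex T τ.symm) k = ang T (τ k) := by
  obtain ⟨a, b, hka, hkb, hab⟩ := exists_others k
  rw [ang_eq _ hka hkb hab, ang_eq T (τ.injective.ne hka) (τ.injective.ne hkb)
    (τ.injective.ne hab)]
  rfl

end Reptile

/-! ### The theorem. -/

theorem theorem6 (T : Reptile.Tri) (hT : Reptile.IsOblique T)
    (r : ℕ) (t : Fin r → Reptile.Tri) (ht : Reptile.IsReptiling T t)
    (hnontrivial : ¬ Reptile.IsTrivialReptiling T t) :
    ∃ v ∈ T.interior, Reptile.IsHalfVertex T t v := by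
  by_contra hno
  obtain ⟨ρ, σ, hρ, hd⟩ := Reptile.exists_labelling ht
  -- The corners of `T` are sorted so that label `2` has the largest angle, and the tiles are
  -- relabelled to match.
  let τ : Equiv.Perm (Fin 3) := Tuple.sort (Reptile.ang T)
  have hmono : Monotone (Reptile.ang T ∘ τ) := Tuple.monotone_sort _
  let T' : Reptile.Tri := T.reindex τ.symm
  let t' : Fin r → Reptile.Tri := fun i => (t i).reindex (τ.trans (σ i)).symm
  have hpt : ∀ i k, (t' i).points k = (t i).points (σ i (τ k)) := fun i k => rfl
  have hci : ∀ i, (t' i).closedInterior = (t i).closedInterior := fun i =>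
    Affine.Simplex.closedInterior_reindex _ _
  have hE : Reptile.EdgeTiling T' t' ρ := by
    refine ⟨?_, ?_, hρ, ?_, ?_⟩
    · rw [show T'.closedInterior = T.closedInterior from
        Affine.Simplex.closedInterior_reindex _ _, ← ht.covers]
      simp_rw [hci]
    · intro i j hij
      rw [Affine.Simplex.interior_reindex, Affine.Simplex.interior_reindex]
      exact ht.disjoint i j hij
    · intro i k l
      exact hd i _ _
    · intro i j k hk
      rw [hci, hpt] at hk
      obtain ⟨l, hl⟩ := Reptile.corner_of_mem ht hno i j _ hk
      refine ⟨(τ.trans (σ j)).symm l, ?_⟩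
      rw [hpt, hl, hpt]
      congr 1
      exact ((τ.trans (σ j)).apply_symm_apply l).symm
  have hang : ∀ k, Reptile.ang T' k = Reptile.ang T (τ k) := Reptile.ang_reindex T τ
  obtain ⟨n, hn, _, hrange⟩ := Reptile.EdgeTiling.range_eq_symCells r hE
    (by rw [hang, hang]; exact hmono (by decide)) (by rw [hang, hang]; exact hmono (by decide))
    (by rw [hang]; exact hT _) (Fintype.card_fin r)
  refine hnontrivial ⟨n, hn, ?_⟩
  simp_rw [hci] at hrange
  rw [hrange, Reptile.gridCells_eq_symCells T hn]
  exact Reptile.symCells_comp T.points n τ
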